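/- **Conventions.** Write $[m]=\{1,\dots,m\}$, let $\mathrm{Sym}(m)$ be the symmetric group on $[m]$ and $u_m$ the uniform probability measure on $[m]$. For a probability measure $\nu$ on a finite set, $H(\nu)=-\sum_x\nu(\{x\})\log\nu(\{x\})$ with $0\log 0=0$. The set $\mathrm{Sym}(m)^{\mathbb Z}$ of all maps $\mathbb Z\to\mathrm{Sym}(m)$ carries the product $\sigma$-algebra. A *random sofic approximation* of $\mathbb Z$ is a sequence $\mathbb K=\{\kappa_i\}_{i\ge1}$ of probability measures $\kappa_i$ on $\mathrm{Sym}(m_i)^{\mathbb Z}$, with integers $m_i\ge1$, such that for all $g,h\in\mathbb Z$ $$\kappa_i\times u_{m_i}\big(\{(\sigma,p):\sigma(g)\sigma(h)p=\sigma(g+h)p\}\big)\to1,$$ and for all $g\ne h$ in $\mathbb Z$ $$\kappa_i\times u_{m_i}\big(\{(\sigma,p):\sigma(g)p\neq\sigma(h)p\}\big)\to1 .$$ An *approximate process* over $\mathbb Z$ with range the finite set $A$ is a quadruple $\overline X=(T,X,\mu,\phi)$, where $(X,\mu)$ is a standard probability space, $T_g:X\to X$ ($g\in\mathbb Z$) are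 measure-preserving maps and $\phi:X\to A$ is measurable. It is a *process* if $T_{g+h}=T_gT_h$ for all $g,h$. For finite $W\subset\mathbb Z$ let $\phi^W:X\to A^W$, $\phi^W(x)(w)=\phi(T_wx)$. Let $d_W(\overline X,\overline Y)$ be the total variation distance $\frac12\|\cdot\|_1$ between the laws of $\phi^W$ for $\overline X$ and for $\overline Y$. Say that $\overline X_j\to\overline X$ if $d_W(\overline X_j,\overline X)\to0$ for every finite $W$. *Classical entropy.* $h(\overline X)=\lim_n H(\phi^{F_n}_*\mu)/|F_n|$, where $\{F_n\}$ is any Følner sequence of finite subsets of $\mathbb Z$, that is: for every nonempty finite $K\subset\mathbb Z$ and $\epsilon>0$, $|(K+F_n)\cap F_n|\ge(1-\epsilon)|F_n|$ with $F_n\neq\emptyset$ for all large $n$. *Sofic entropy.* For $\sigma\in\mathrm{Sym}(m_i)^{\mathbb Z}$, finite $W\subset\mathbb Z$ and $\epsilon>0$, let $N_i(\sigma,W,\epsilon)$ be the number of $\psi:[m_i]\to A$ for which the law of $p\mapsto(\psi(\sigma(w)p))_{w\in W}$ under $u_{m_i}$ is at total variation distance less than $\epsilon$ from $\phi^W_*\mu$.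 Then $$h(\mathbb K,\overline X)=\inf_{W}\inf_{\epsilon>0}\limsup_{i\to\infty}\frac1{m_i}\int_{\{\sigma:\,N_i(\sigma,W,\epsilon)>0\}}\log N_i(\sigma,W,\epsilon)\,d\kappa_i(\sigma),$$ where the normalized integral is read as $-\infty$ if $N_i(\sigma,W,\epsilon)=0$ for $\kappa_i$-almost every $\sigma$. *Upper-sofic entropy.* Let $\eta$ be a probability measure on $\mathrm{Sym}(m_i)^{\mathbb Z}\times A^{[m_i]}$ with first marginal $\kappa_i$. It determines an approximate process $\overline X_\eta$ on $(\mathrm{Sym}(m_i)^{\mathbb Z}\times A^{[m_i]}\times[m_i],\ \eta\times u_{m_i})$, with maps $(\sigma,\psi,p)\mapsto(\sigma,\psi,\sigma(g)p)$ and observable $(\sigma,\psi,p)\mapsto\psi(p)$. Put $h(\overline X_\eta)=\frac1{m_i}\int H(\nu_\sigma)\,d\kappa_i(\sigma)$, where $\nu_\sigma$ is the conditional law on $A^{[m_i]}$ given $\sigma$ under $\eta$. Then $\bar h(\mathbb K,\overline X)=\sup\limsup_{j\to\infty}h(\overline X_{\eta_j})$. The supremum is over all subsequences $\{\kappa_{i_j}\}_{j\ge1}$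 of $\mathbb K$ and all sequences of measures $\eta_j$ with first marginals $\kappa_{i_j}$ such that $\overline X_{\eta_j}\to\overline X$; it is $-\infty$ if there are none. **Proposition.** Let $\mathbb K$ be a random sofic approximation of $\mathbb Z$ and let $\overline X$ be a process over $\mathbb Z$ with finite range. Then the limit defining $h(\overline X)$ exists, is finite and is the same for every Følner sequence of $\mathbb Z$, and $$\bar h(\mathbb K,\overline X)=h(\mathbb K,\overline X)=h(\overline X).$$ -/

import Mathlib

open MeasureTheory ProbabilityTheory Filter Topology
open scoped Pointwise

universe u u' v w

noncomputable section

namespace SoficZ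

/-! Groups are written additively, since the theorem is about the group of integers. -/

/-- The symmetric group on the `m` points `Fin m`. -/
abbrev Sym (m : ℕ) : Type := Equiv.Perm (Fin m)

/-- The finite set `Sym m` is discrete. The set of maps `G → Sym m` gets the product
sigma-algebra, which for countable `G` is its Borel sigma-algebra. -/
instance instMeasurableSpaceSym (m : ℕ) : MeasurableSpace (Sym m) := ⊤

instance instDiscreteSym (m : ℕ) : DiscreteMeasurableSpace (Sym m) := ⟨fun _ => trivial⟩

/-- The uniform probability measure on the `m` points `Fin m`. -/
abbrev unif (m : ℕ) : Measure (Fin m) := uniformOn Set.univ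

instance instProbUnif (m : ℕ) [NeZero m] : IsProbabilityMeasure (unif m) :=
  isProbabilityMeasure_uniformOn Set.finite_univ Set.univ_nonempty

/-- The Shannon entropy (natural logarithm, `0 log 0 = 0`) of a probability measure on a
finite set. -/
def shannonEntropy {S : Type*} [MeasurableSpace S] (ν : Measure S) : ℝ :=
  ∑' a, Real.negMulLog (ν.real {a})

/-- The total variation distance `(1/2) ‖ν - ν'‖₁` of two probability measures on a finite or
countable set. -/
def tvDist {S : Type*} [MeasurableSpace S] (ν ν' : Measure S) : ℝ :=
  (1 / 2) * ∑' a, |ν.real {a} - ν'.real {a}|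

/-! ### Random sofic approximations -/

/-- A random sofic approximation to `G`: a sequence of probability measures `κ i` on the set of
all maps `G → Sym (m i)`, where `m i ≥ 1`. -/
structure RandomSoficApprox (G : Type*) [AddGroup G] where
  m : ℕ → ℕ
  neZero : ∀ i, NeZero (m i)
  κ : ∀ i, Measure (G → Sym (m i))
  isProb : ∀ i, IsProbabilityMeasure (κ i)
  tendsto_add : ∀ g h : G, Tendsto
    (fun i => ((κ i).prod (unif (m i))) {q | q.1 g (q.1 h q.2) = q.1 (g + h) q.2}) atTop (𝓝 1)
  tendsto_ne : ∀ g h : G, g ≠ h → Tendsto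
    (fun i => ((κ i).prod (unif (m i))) {q | q.1 g q.2 ≠ q.1 h q.2}) atTop (𝓝 1)

attribute [instance] RandomSoficApprox.neZero RandomSoficApprox.isProb

/-! ### Approximate processes and processes -/

/-- An approximate process over `G` with values in the (finite or countable, discrete) set `A`:
measure-preserving maps `T g` of a standard probability space together with an observable `φ`.
The maps are not assumed to form an action. -/
structure ApproxProcess (G : Type v) (A : Type w) [MeasurableSpace A] where
  Ω : Type u
  measurableSpace : MeasurableSpace Ω
  standardBorel : StandardBorelSpace Ω
  μ : Measure Ω
  isProb : IsProbabilityMeasure μ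
  T : G → Ω → Ω
  measurePreserving : ∀ g, MeasurePreserving (T g) μ μ
  φ : Ω → A
  measurable_φ : Measurable φ

attribute [instance] ApproxProcess.measurableSpace ApproxProcess.standardBorel
  ApproxProcess.isProb

/-- An approximate process is a process if its maps form an action of the group. -/
def ApproxProcess.IsAction {G : Type v} {A : Type w} [AddGroup G] [MeasurableSpace A]
    (X : ApproxProcess.{u} G A) : Prop :=
  ∀ g h : G, X.T (g + h) = X.T g ∘ X.T h

/-- The `W`-local statistics of an approximate process: the law of `w ↦ φ (T w x)` on `A^W`. -/
def ApproxProcess.localStats {G : Type v} {A : Type w} [MeasurableSpace A] (X : ApproxProcess.{u} G A)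
    (W : Finset G) : Measure (W → A) :=
  X.μ.map (fun x w => X.φ (X.T w x))

/-- The distance `d_W` between two approximate processes. -/
def ApproxProcess.dist {G : Type v} {A : Type w} [MeasurableSpace A] (W : Finset G)
    (X : ApproxProcess.{u} G A) (Y : ApproxProcess.{u'} G A) : ℝ :=
  tvDist (X.localStats W) (Y.localStats W)

/-- Convergence of approximate processes. The topology is the smallest one that makes all the
pseudo-distances `d_W` (`W` finite) continuous, so a sequence converges to `X` if and only if
its `d_W`-distance to `X` tends to `0` for every `W`. -/
def ConvergesTo {G : Type v} {A : Type w} [MeasurableSpace A] (Y : ℕ → ApproxProcess.{u} G A)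
    (X : ApproxProcess.{u'} G A) : Prop :=
  ∀ W : Finset G, Tendsto (fun j => ApproxProcess.dist W (Y j) X) atTop (𝓝 0)

/-! ### Sofic entropy -/

/-- The distance `d_W((σ, ψ), φ)` between the local statistics of `ψ : Fin m → A`, moved by
`σ : G → Sym m`, and those of a process. -/
def modelDist {G : Type v} {A : Type w} [MeasurableSpace A] {m : ℕ} (W : Finset G)
    (σ : G → Sym m) (ψ : Fin m → A) (X : ApproxProcess.{u} G A) : ℝ :=
  tvDist (X.localStats W) ((unif m).map (fun p (w : W) => ψ (σ w p)))

/-- The number `N(σ, W, ε)` of maps `ψ : Fin m → A` with `d_W((σ, ψ), φ) < ε`. -/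
def numModels {G : Type v} {A : Type w} [MeasurableSpace A] {m : ℕ} (X : ApproxProcess.{u} G A)
    (W : Finset G) (ε : ℝ) (σ : G → Sym m) : ℕ :=
  {ψ : Fin m → A | modelDist W σ ψ X < ε}.ncard

open Classical in
/-- The average `(1/m) ∫ log N(σ, W, ε) dκ(σ)`, taken over the maps `σ` with
`N(σ, W, ε) > 0` (`Real.log 0 = 0`), and `-∞` if `κ`-almost no `σ` has `N(σ, W, ε) > 0`.
For `κ` a point mass this is `(1/m) log N(σ, W, ε)` with `log 0 = -∞`. -/
def avgLogNumModels {G : Type v} {A : Type w} [MeasurableSpace A] {m : ℕ} (κ : Measure (G → Sym m))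
    (X : ApproxProcess.{u} G A) (W : Finset G) (ε : ℝ) : EReal :=
  if κ {σ | 0 < numModels X W ε σ} = 0 then ⊥
  else (((∫ σ, Real.log (numModels X W ε σ) ∂κ) / m : ℝ) : EReal)

/-- The sofic entropy of `X` with respect to a random sofic approximation. -/
def soficEntropy {G : Type v} {A : Type w} [AddGroup G] [MeasurableSpace A] (K : RandomSoficApprox G)
    (X : ApproxProcess.{u} G A) : EReal :=
  ⨅ (W : Finset G) (ε : ℝ) (_ : 0 < ε),
    limsup (fun i => avgLogNumModels (K.κ i) X W ε) atTop

/-! ### Upper-sofic entropy -/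

theorem measurable_perm_apply {m : ℕ} :
    Measurable (fun q : Sym m × Fin m => q.1 q.2) :=
  measurable_of_finite _

theorem map_perm_unif {m : ℕ} [NeZero m] (s : Sym m) : (unif m).map s = unif m := by
  ext t ht
  rw [Measure.map_apply (measurable_of_finite _) ht]
  simp only [unif, uniformOn, cond_apply MeasurableSet.univ, Set.univ_inter]
  congr 1
  have e : (s : Fin m → Fin m) ⁻¹' t = (s.symm : Fin m → Fin m) '' t :=
    (Equiv.image_symm_eq_preimage s t).symm
  rw [e, Measure.count_injective_image s.symm.injective]

/-- The approximate process constructed from a probability measure `η` on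
`(G → Sym m) × A^m`. -/
def constructed {G : Type v} {A : Type w} [Countable G] [Countable A] [MeasurableSpace A]
    [DiscreteMeasurableSpace A] {m : ℕ} [NeZero m]
    (η : Measure ((G → Sym m) × (Fin m → A))) [IsProbabilityMeasure η] :
    ApproxProcess G A where
  Ω := ((G → Sym m) × (Fin m → A)) × Fin m
  measurableSpace := inferInstance
  standardBorel := inferInstance
  μ := η.prod (unif m)
  isProb := inferInstance
  T g q := (q.1, q.1.1 g q.2)
  measurePreserving g := by
    have h : Measurable (fun q : ((G → Sym m) × (Fin m → A)) × Fin m => (q.1.1 g, q.2)) :=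
      ((measurable_pi_apply g).comp (measurable_fst.comp measurable_fst)).prodMk measurable_snd
    exact (MeasurePreserving.id η).skew_product
      (g := fun (a : (G → Sym m) × (Fin m → A)) (p : Fin m) => a.1 g p)
      (measurable_perm_apply.comp h) (ae_of_all _ fun a => map_perm_unif (a.1 g))
  φ q := q.1.2 q.2
  measurable_φ :=
    (measurable_of_countable (fun q : (Fin m → A) × Fin m => q.1 q.2)).comp
      ((measurable_snd.comp measurable_fst).prodMk measurable_snd)

/-- The entropy `(1/m) ∫ H(ν_σ) dκ(σ)` of the approximate process constructed from `η`, where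
`κ` is the first marginal of `η` and `ν_σ` is the conditional law on `A^m` given `σ`. -/
def condEntropy {G : Type v} {A : Type w} [Countable G] [Countable A] [Nonempty A] [MeasurableSpace A]
    [DiscreteMeasurableSpace A] {m : ℕ}
    (η : Measure ((G → Sym m) × (Fin m → A))) [IsProbabilityMeasure η] : ℝ :=
  (∫ σ, shannonEntropy (η.condKernel σ) ∂η.fst) / m

/-- The upper-sofic entropy of `X`: the supremum of `limsup h(X_j)` over all sequences of
approximate processes `X_j`, adapted to a subsequence of `K`, that converge to `X`. It is
`-∞` if there is no such sequence. -/
def upperSoficEntropy {G : Type v} {A : Type w} [AddGroup G] [Countable G] [Countable A] [Nonempty A]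
    [MeasurableSpace A] [DiscreteMeasurableSpace A] (K : RandomSoficApprox G)
    (X : ApproxProcess.{u} G A) : EReal :=
  sSup {L : EReal | ∃ n : ℕ → ℕ, StrictMono n ∧
    ∃ η : ∀ j, Measure ((G → Sym (K.m (n j))) × (Fin (K.m (n j)) → A)),
    ∃ _ : ∀ j, IsProbabilityMeasure (η j),
      (∀ j, (η j).fst = K.κ (n j)) ∧
      ConvergesTo (fun j => constructed (η j)) X ∧
      L = limsup (fun j => (condEntropy (η j) : EReal)) atTop}

/-! ### Classical entropy -/

open Classical in
/-- A left-Følner sequence: for every finite nonempty `K` and every `ε > 0`, eventually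
`|(K + F n) ∩ F n| / |F n| ≥ 1 - ε`. -/
def IsLeftFolner {G : Type*} [AddGroup G] (F : ℕ → Finset G) : Prop :=
  ∀ K : Finset G, K.Nonempty → ∀ ε : ℝ, 0 < ε → ∃ N, ∀ n, N < n →
    1 - ε ≤ (((K + F n) ∩ F n).card : ℝ) / (F n).card

/-- `h` is the classical entropy of `X`: the limit of `H(φ^{F n}) / |F n|` along every
left-Følner sequence `F`. -/
def HasClassicalEntropy {G : Type v} {A : Type w} [AddGroup G] [MeasurableSpace A] (X : ApproxProcess.{u} G A)
    (h : ℝ) : Prop :=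
  ∀ F : ℕ → Finset G, IsLeftFolner F →
    Tendsto (fun n => shannonEntropy (X.localStats (F n)) / (F n).card) atTop (𝓝 h)

end SoficZ

end

/-!
Every random sofic approximation of the integers is, up to relabelling the points, close to the
translation of an interval. A permutation `τ` of `Fin m` can be unrolled: list the points so that
each point that is not the least one of its cycle follows its predecessor on the cycle
(`exists_rank`). For `τ = σ 1` the exceptional points are rare, because short cycles are negligible
and long cycles are few (`negligible_cuts`). Hence `σ w` raises the position in this list by `w`
outside a set of small probability (`negligible_rank`).

*Classical entropy.* By submodularity of entropy and stationarity, the conditional entropy of the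
present given the last `k` values decreases in `k`; let `X.rate` be its infimum. The chain rule in
increasing order of time gives `|F| * X.rate ≤ H(F)` for all finite sets `F` of times, and
`H(F)` is at most `|F|` times the conditional entropy given the last `k` values, up to the points
of `F` whose `k` predecessors are not all in `F`. These have small density in a Følner set
(`ApproxProcess.hasClassicalEntropy_rate`).

*Upper bounds.* A configuration `ψ : Fin m → A` is coded letter by letter, in the order of the
list, with code lengths `-log Q(letter | last k letters)`, where `Q` is the conditional law of the
process mixed with the uniform law. The weights `exp (-length)` sum to at most one
(`sum_prod_transition_le_one`), and the length is a linear functional of the local statistics of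
`ψ` up to the exceptional points (`exists_code`). So a model has code length at most
`m * (X.rate + small)`, which bounds the number of models (`soficEntropy_le`). By Gibbs' inequality
the mean code length bounds the entropy of any law on configurations (`upperSoficEntropy_le`); being
linear in the statistics, this bound is unaffected by averaging over `σ`.

*Lower bounds.* Read the process along the list, `ψ(p) = φ(T_{rank p} x_{block of p})`, with an
independent starting point for each block. Each block contributes at least its length times
`X.rate` to the entropy (`mul_rate_le_shannonEntropy_drawLaw`), and at points well inside a
block the local statistics are exactly those of the process. With a single block this gives
`le_upperSoficEntropy`. For a process that is not ergodic one orbit does not show the statistics of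
the process, but with many long blocks Chebyshev's inequality shows that `ψ` is a model with high
probability (`drawLaw_not_model_le`), so that there are at least `exp (m * (X.rate - small))`
models (`le_soficEntropy`).
-/

noncomputable section

namespace SoficZ

/-! ### Entropy of finite-valued observables -/

section Entropy

variable {Ω : Type*} [MeasurableSpace Ω] {μ : Measure Ω}

theorem integrable_comp_of_finite {S : Type*} [Finite S] [MeasurableSpace S]
    [MeasurableSingletonClass S] [IsFiniteMeasure μ] {f : Ω → S} (hf : Measurable f) (G : S → ℝ) :
    Integrable (fun x => G (f x)) μ :=
  (Integrable.of_finite (μ := μ.map f) (f := G)).comp_measurable hf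

theorem integral_comp_eq_sum {S : Type*} [Fintype S] [MeasurableSpace S]
    [MeasurableSingletonClass S] [IsFiniteMeasure μ] {f : Ω → S} (hf : Measurable f) (G : S → ℝ) :
    ∫ x, G (f x) ∂μ = ∑ s, μ.real (f ⁻¹' {s}) * G s := by
  rw [← integral_map (μ := μ) hf.aemeasurable
    (Measurable.of_discrete (f := G)).aestronglyMeasurable,
    integral_fintype (Integrable.of_finite)]
  refine Finset.sum_congr rfl fun s _ => ?_
  rw [map_measureReal_apply hf (MeasurableSet.singleton s), smul_eq_mul]

/-- The entropy of the partition of `Ω` into the fibres of `f`, written as the mean of the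
information `-log μ(fibre of x)`. In this form it depends on `f` only through its fibres. -/
def fiberEntropy (μ : Measure Ω) {S : Type*} (f : Ω → S) : ℝ :=
  ∫ x, -Real.log (μ.real {y | f y = f x}) ∂μ

theorem fiberEntropy_eq_sum {S : Type*} [Fintype S] [MeasurableSpace S]
    [MeasurableSingletonClass S] [IsFiniteMeasure μ] {f : Ω → S} (hf : Measurable f) :
    fiberEntropy μ f = ∑ s, Real.negMulLog (μ.real (f ⁻¹' {s})) := by
  unfold fiberEntropy
  have := integral_comp_eq_sum (μ := μ) hf (fun s => -Real.log (μ.real (f ⁻¹' {s})))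
  refine this.trans (Finset.sum_congr rfl fun s _ => ?_)
  simp [Real.negMulLog]

theorem shannonEntropy_map {S : Type*} [Finite S] [MeasurableSpace S]
    [MeasurableSingletonClass S] [IsFiniteMeasure μ] {f : Ω → S} (hf : Measurable f) :
    shannonEntropy (μ.map f) = fiberEntropy μ f := by
  cases nonempty_fintype S
  rw [fiberEntropy_eq_sum hf, shannonEntropy, tsum_fintype]
  refine Finset.sum_congr rfl fun s _ => ?_
  rw [map_measureReal_apply hf (MeasurableSet.singleton s)]

theorem fiberEntropy_congr {S T : Type*} {f : Ω → S} {g : Ω → T}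
    (h : ∀ x y, f y = f x ↔ g y = g x) : fiberEntropy μ f = fiberEntropy μ g := by
  unfold fiberEntropy
  congr with x
  congr 3
  ext y
  exact h x y

theorem integrable_log_fiber {S : Type*} [Finite S] [MeasurableSpace S]
    [MeasurableSingletonClass S] [IsFiniteMeasure μ] {f : Ω → S} (hf : Measurable f) :
    Integrable (fun x => -Real.log (μ.real {y | f y = f x})) μ :=
  integrable_comp_of_finite hf (fun s => -Real.log (μ.real (f ⁻¹' {s})))

theorem ae_fiber_pos {S : Type*} [Finite S] [MeasurableSpace S]
    [MeasurableSingletonClass S] [IsFiniteMeasure μ] (f : Ω → S) :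
    ∀ᵐ x ∂μ, 0 < μ.real {y | f y = f x} := by
  have : ∀ s : S, ∀ᵐ x ∂μ, f x = s → 0 < μ.real {y | f y = s} := by
    intro s
    rcases eq_or_ne (μ {y | f y = s}) 0 with h0 | h0
    · filter_upwards [measure_eq_zero_iff_ae_notMem.1 h0] with x hx hs
      exact absurd hs hx
    · exact ae_of_all _ fun x _ => ENNReal.toReal_pos h0 (measure_ne_top _ _)
  filter_upwards [ae_all_iff.2 this] with x hx
  exact hx _ rfl

theorem fiberEntropy_mono [IsProbabilityMeasure μ] {S T : Type*} [Finite S] [MeasurableSpace S]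
    [MeasurableSingletonClass S] [Finite T] [MeasurableSpace T]
    [MeasurableSingletonClass T] {f : Ω → S} {g : Ω → T} (hf : Measurable f) (hg : Measurable g)
    (h : ∀ x y, f y = f x → g y = g x) : fiberEntropy μ g ≤ fiberEntropy μ f := by
  refine integral_mono_ae (integrable_log_fiber hg) (integrable_log_fiber hf) ?_
  filter_upwards [ae_fiber_pos (μ := μ) f] with x hx
  exact neg_le_neg (Real.log_le_log hx (measureReal_mono fun y hy => h x y hy))

/-- Gibbs' inequality: entropy is at most the cross-entropy against any subprobability vector
that is positive on the support. -/
theorem sum_negMulLog_le {ι : Type*} (s : Finset ι) (p q : ι → ℝ) (hp : ∀ i ∈ s, 0 ≤ p i)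
    (hq : ∀ i ∈ s, 0 ≤ q i) (hpq : ∀ i ∈ s, p i ≠ 0 → q i ≠ 0)
    (hs : ∑ i ∈ s, q i ≤ ∑ i ∈ s, p i) :
    ∑ i ∈ s, Real.negMulLog (p i) ≤ ∑ i ∈ s, p i * -Real.log (q i) := by
  have key : ∀ i ∈ s, Real.negMulLog (p i) ≤ p i * -Real.log (q i) + (q i - p i) := by
    intro i hi
    rcases (hp i hi).eq_or_lt with h0 | h0
    · simp [← h0, hq i hi]
    · have hq0 : 0 < q i := lt_of_le_of_ne (hq i hi) (hpq i hi h0.ne').symm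
      have := Real.log_le_sub_one_of_pos (div_pos hq0 h0)
      rw [Real.log_div hq0.ne' h0.ne'] at this
      have h2 := mul_le_mul_of_nonneg_left this h0.le
      have h3 : p i * (q i / p i - 1) = q i - p i := by field_simp
      rw [h3] at h2
      simp only [Real.negMulLog]
      nlinarith
  have := Finset.sum_le_sum key
  rw [Finset.sum_add_distrib, Finset.sum_sub_distrib] at this
  linarith

theorem fiberEntropy_le_log_card [IsProbabilityMeasure μ] {S : Type*} [Fintype S] [Nonempty S]
    [MeasurableSpace S] [MeasurableSingletonClass S] {f : Ω → S} (hf : Measurable f) :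
    fiberEntropy μ f ≤ Real.log (Fintype.card S) := by
  have hsum : ∑ s, μ.real (f ⁻¹' {s}) = 1 := by
    have := integral_comp_eq_sum (μ := μ) hf (fun _ => (1 : ℝ))
    simpa using this.symm
  have hc : (0 : ℝ) < Fintype.card S := by exact_mod_cast Fintype.card_pos
  rw [fiberEntropy_eq_sum hf]
  refine (sum_negMulLog_le Finset.univ (fun s => μ.real (f ⁻¹' {s}))
    (fun _ => (Fintype.card S : ℝ)⁻¹) (fun _ _ => measureReal_nonneg) (fun _ _ => by positivity)
    (fun _ _ _ => by positivity) ?_).trans ?_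
  · simp [hsum, hc.ne']
  · rw [← Finset.sum_mul, hsum]; simp

/-- Submodularity of entropy: conditioning on more information does not increase the conditional
entropy. -/
theorem fiberEntropy_submodular [IsProbabilityMeasure μ] {S T U : Type*}
    [Finite S] [MeasurableSpace S] [MeasurableSingletonClass S]
    [Finite T] [MeasurableSpace T] [MeasurableSingletonClass T]
    [Finite U] [MeasurableSpace U] [MeasurableSingletonClass U]
    {f : Ω → S} {g : Ω → T} {k : Ω → U} (hf : Measurable f) (hg : Measurable g)
    (hk : Measurable k) :
    fiberEntropy μ (fun x => (f x, g x, k x)) + fiberEntropy μ k ≤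
      fiberEntropy μ (fun x => (f x, k x)) + fiberEntropy μ (fun x => (g x, k x)) := by
  cases nonempty_fintype S
  cases nonempty_fintype T
  cases nonempty_fintype U
  have hfgk : Measurable (fun x => (f x, g x, k x)) := hf.prodMk (hg.prodMk hk)
  have hfk : Measurable (fun x => (f x, k x)) := hf.prodMk hk
  have hgk : Measurable (fun x => (g x, k x)) := hg.prodMk hk
  set P3 : S × T × U → ℝ := fun z => μ.real ((fun x => (f x, g x, k x)) ⁻¹' {z}) with hP3
  set Pf : S → U → ℝ := fun s c => μ.real ((fun x => (f x, k x)) ⁻¹' {(s, c)}) with hPf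
  set Pg : T → U → ℝ := fun t c => μ.real ((fun x => (g x, k x)) ⁻¹' {(t, c)}) with hPg
  set Pk : U → ℝ := fun c => μ.real (k ⁻¹' {c}) with hPk
  have sumk : ∑ c, Pk c = 1 := by
    simpa using (integral_comp_eq_sum (μ := μ) hk (fun _ => (1 : ℝ))).symm
  have sumf : ∀ c, ∑ s, Pf s c = Pk c := by
    intro c
    have := measureReal_biUnion_finset (μ := μ) (s := Finset.univ)
      (f := fun s : S => (fun x => (f x, k x)) ⁻¹' {(s, c)})
      (by
        intro s _ s' _ hss
        refine Set.disjoint_left.2 fun x hx hx' => hss ?_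
        have h1 : f x = s := congrArg Prod.fst (by simpa using hx : (f x, k x) = (s, c))
        have h2 : f x = s' := congrArg Prod.fst (by simpa using hx' : (f x, k x) = (s', c))
        exact h1.symm.trans h2)
      (fun s _ => hfk (MeasurableSet.singleton _))
    rw [← this]
    congr 1
    ext x
    simp
  have sumg : ∀ c, ∑ t, Pg t c = Pk c := by
    intro c
    have := measureReal_biUnion_finset (μ := μ) (s := Finset.univ)
      (f := fun s : T => (fun x => (g x, k x)) ⁻¹' {(s, c)})
      (by
        intro s _ s' _ hss
        refine Set.disjoint_left.2 fun x hx hx' => hss ?_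
        have h1 : g x = s := congrArg Prod.fst (by simpa using hx : (g x, k x) = (s, c))
        have h2 : g x = s' := congrArg Prod.fst (by simpa using hx' : (g x, k x) = (s', c))
        exact h1.symm.trans h2)
      (fun s _ => hgk (MeasurableSet.singleton _))
    rw [← this]
    congr 1
    ext x
    simp
  have sum3 : ∑ z, P3 z = 1 := by
    simpa using (integral_comp_eq_sum (μ := μ) hfgk (fun _ => (1 : ℝ))).symm
  have P3f : ∀ s t c, P3 (s, t, c) ≤ Pf s c := fun s t c =>
    measureReal_mono (fun x hx => by
      simp only [Set.mem_preimage, Set.mem_singleton_iff, Prod.mk.injEq] at hx ⊢; tauto)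
  have P3g : ∀ s t c, P3 (s, t, c) ≤ Pg t c := fun s t c =>
    measureReal_mono (fun x hx => by
      simp only [Set.mem_preimage, Set.mem_singleton_iff, Prod.mk.injEq] at hx ⊢; tauto)
  have P3k : ∀ s t c, P3 (s, t, c) ≤ Pk c := fun s t c =>
    measureReal_mono (fun x hx => by
      simp only [Set.mem_preimage, Set.mem_singleton_iff, Prod.mk.injEq] at hx ⊢; tauto)
  have P3nn : ∀ z, 0 ≤ P3 z := fun z => measureReal_nonneg
  have Pfnn : ∀ s c, 0 ≤ Pf s c := fun s c => measureReal_nonneg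
  have Pgnn : ∀ s c, 0 ≤ Pg s c := fun s c => measureReal_nonneg
  have Pknn : ∀ c, 0 ≤ Pk c := fun c => measureReal_nonneg
  have pos : ∀ z, P3 z ≠ 0 → 0 < Pf z.1 z.2.2 ∧ 0 < Pg z.2.1 z.2.2 ∧ 0 < Pk z.2.2 := by
    intro z hz
    have hz' : 0 < P3 z := lt_of_le_of_ne (P3nn z) hz.symm
    exact ⟨hz'.trans_le (P3f _ _ _), hz'.trans_le (P3g _ _ _), hz'.trans_le (P3k _ _ _)⟩
  -- The comparison vector makes `f` and `g` conditionally independent given `k`.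
  have gibbs := sum_negMulLog_le Finset.univ P3
    (fun z => Pf z.1 z.2.2 * Pg z.2.1 z.2.2 / Pk z.2.2) (fun z _ => P3nn z)
    (fun z _ => div_nonneg (mul_nonneg (Pfnn _ _) (Pgnn _ _)) (Pknn _))
    (fun z _ hz => by
      obtain ⟨h1, h2, h3⟩ := pos z hz
      positivity)
    (by
      rw [sum3, ← sumk]
      rw [Fintype.sum_prod_type, Finset.sum_congr rfl
        (fun s _ => Fintype.sum_prod_type_right _), Finset.sum_comm]
      refine Finset.sum_le_sum fun c _ => ?_
      simp only
      have : ∑ s, ∑ t, Pf s c * Pg t c / Pk c = (∑ s, Pf s c) * (∑ t, Pg t c) / Pk c := by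
        rw [Finset.sum_mul_sum, Finset.sum_div]
        exact Finset.sum_congr rfl fun s _ => (Finset.sum_div _ _ _).symm
      rw [this, sumf, sumg]
      rcases eq_or_ne (Pk c) 0 with h | h
      · simp [h]
      · rw [mul_div_cancel_right₀ _ h])
  have e3 : fiberEntropy μ (fun x => (f x, g x, k x)) = ∑ z, Real.negMulLog (P3 z) :=
    fiberEntropy_eq_sum hfgk
  have ek : fiberEntropy μ k = ∑ z : S × T × U, P3 z * -Real.log (Pk z.2.2) := by
    rw [← integral_comp_eq_sum (μ := μ) hfgk (fun z : S × T × U => -Real.log (Pk z.2.2))]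
    rfl
  have ef : fiberEntropy μ (fun x => (f x, k x)) =
      ∑ z : S × T × U, P3 z * -Real.log (Pf z.1 z.2.2) := by
    rw [← integral_comp_eq_sum (μ := μ) hfgk (fun z : S × T × U => -Real.log (Pf z.1 z.2.2))]
    rfl
  have eg : fiberEntropy μ (fun x => (g x, k x)) =
      ∑ z : S × T × U, P3 z * -Real.log (Pg z.2.1 z.2.2) := by
    rw [← integral_comp_eq_sum (μ := μ) hfgk (fun z : S × T × U => -Real.log (Pg z.2.1 z.2.2))]
    rfl
  rw [e3, ek, ef, eg]
  have : ∑ z : S × T × U, P3 z * -Real.log (Pf z.1 z.2.2 * Pg z.2.1 z.2.2 / Pk z.2.2) +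
      ∑ z : S × T × U, P3 z * -Real.log (Pk z.2.2) = ∑ z : S × T × U,
      (P3 z * -Real.log (Pf z.1 z.2.2) + P3 z * -Real.log (Pg z.2.1 z.2.2)) := by
    rw [← Finset.sum_add_distrib]
    refine Finset.sum_congr rfl fun z _ => ?_
    rcases eq_or_ne (P3 z) 0 with h | h
    · simp [h]
    · obtain ⟨h1, h2, h3⟩ := pos z h
      rw [Real.log_div (by positivity) h3.ne', Real.log_mul h1.ne' h2.ne']
      ring
  rw [Finset.sum_add_distrib] at this
  linarith

end Entropy

/-! ### Classical entropy of a process over the integers -/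

section Classical

variable {A : Type w} [MeasurableSpace A]

/-- The values of the observable at the times `r i`, seen from the point `x`. -/
def ApproxProcess.sample (X : ApproxProcess.{u} ℤ A) {ι : Type*} (r : ι → ℤ) (x : X.Ω) : ι → A :=
  fun i => X.φ (X.T (r i) x)

/-- The entropy of the observable restricted to a finite set of times. -/
def ApproxProcess.entropyOn (X : ApproxProcess.{u} ℤ A) (F : Finset ℤ) : ℝ :=
  fiberEntropy X.μ (X.sample ((↑) : F → ℤ))

/-- The conditional entropy of the value at time `s` given the values at the times in `F`. -/
def ApproxProcess.increment (X : ApproxProcess.{u} ℤ A) (s : ℤ) (F : Finset ℤ) : ℝ :=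
  X.entropyOn (insert s F) - X.entropyOn F

/-- The conditional entropy of the present given the last `k` values. -/
def ApproxProcess.pastEntropy (X : ApproxProcess.{u} ℤ A) (k : ℕ) : ℝ :=
  X.increment 0 (Finset.Icc (-k : ℤ) (-1))

/-- The entropy rate: the infimum of the conditional entropies of the present given finite
pasts. -/
def ApproxProcess.rate (X : ApproxProcess.{u} ℤ A) : ℝ := ⨅ k, X.pastEntropy k

theorem ApproxProcess.measurable_sample (X : ApproxProcess.{u} ℤ A) {ι : Type*} (r : ι → ℤ) :
    Measurable (X.sample r) :=
  measurable_pi_lambda _ fun _ => X.measurable_φ.comp (X.measurePreserving _).measurable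

theorem ApproxProcess.localStats_eq (X : ApproxProcess.{u} ℤ A) (W : Finset ℤ) :
    X.localStats W = X.μ.map (X.sample ((↑) : W → ℤ)) := rfl

theorem ApproxProcess.sample_add {X : ApproxProcess.{u} ℤ A} (hX : X.IsAction) {ι : Type*}
    (r : ι → ℤ) (g : ℤ) : X.sample (fun i => r i + g) = X.sample r ∘ X.T g := by
  funext x i
  simp [ApproxProcess.sample, hX (r i) g]

/-- Stationarity: the joint law of finitely many values is invariant under shifts of time. -/
theorem ApproxProcess.map_sample_add {X : ApproxProcess.{u} ℤ A} (hX : X.IsAction) {ι : Type*}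
    (r : ι → ℤ) (g : ℤ) : X.μ.map (X.sample (fun i => r i + g)) = X.μ.map (X.sample r) := by
  rw [ApproxProcess.sample_add hX, ← Measure.map_map (X.measurable_sample r)
    (X.measurePreserving g).measurable, (X.measurePreserving g).map_eq]

theorem ApproxProcess.sample_eq_iff (X : ApproxProcess.{u} ℤ A) (F : Finset ℤ)
    (x y : X.Ω) : X.sample ((↑) : F → ℤ) y = X.sample ((↑) : F → ℤ) x ↔
      ∀ w ∈ F, X.φ (X.T w y) = X.φ (X.T w x) := by
  simp [funext_iff, ApproxProcess.sample]

theorem ApproxProcess.entropyOn_empty (X : ApproxProcess.{u} ℤ A) : X.entropyOn ∅ = 0 := by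
  have : ∀ x, {y | X.sample ((↑) : (∅ : Finset ℤ) → ℤ) y =
      X.sample ((↑) : (∅ : Finset ℤ) → ℤ) x} = Set.univ := fun x =>
    Set.eq_univ_of_forall fun y => (X.sample_eq_iff _ _ _).2 (by simp)
  simp [ApproxProcess.entropyOn, fiberEntropy, this]

/-- The entropy of the values at the times `r i` depends only on the set of these times. -/
theorem ApproxProcess.fiberEntropy_sample (X : ApproxProcess.{u} ℤ A) {ι : Type*} [Fintype ι]
    (r : ι → ℤ) : fiberEntropy X.μ (X.sample r) = X.entropyOn (Finset.univ.image r) := by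
  refine fiberEntropy_congr fun x y => ?_
  rw [X.sample_eq_iff]
  simp [funext_iff, ApproxProcess.sample]

theorem ApproxProcess.exists_pastEntropy_lt (X : ApproxProcess.{u} ℤ A) {c : ℝ} (hc : X.rate < c) :
    ∃ k, X.pastEntropy k < c := exists_lt_of_ciInf_lt hc

/-- The chain rule in increasing order of time. -/
theorem ApproxProcess.entropyOn_eq_sum (X : ApproxProcess.{u} ℤ A) (F : Finset ℤ) :
    X.entropyOn F = ∑ s ∈ F, X.increment s (F.filter (· < s)) := by
  induction F using Finset.induction_on_max with
  | empty => simp [X.entropyOn_empty]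
  | insert a F hF ih =>
    have ha : a ∉ F := fun h => lt_irrefl _ (hF a h)
    rw [Finset.sum_insert ha]
    have h1 : (insert a F).filter (· < a) = F := by
      ext z; simp only [Finset.mem_filter, Finset.mem_insert]
      exact ⟨fun h => h.1.resolve_left h.2.ne, fun h => ⟨Or.inr h, hF z h⟩⟩
    have h2 : ∀ s ∈ F, (insert a F).filter (· < s) = F.filter (· < s) := by
      intro s hs
      rw [Finset.filter_insert, if_neg (not_lt.2 (hF s hs).le)]
    rw [h1, Finset.sum_congr rfl (fun s hs => by rw [h2 s hs]), ← ih]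
    simp [ApproxProcess.increment]

variable [Finite A] [DiscreteMeasurableSpace A]

theorem ApproxProcess.shannonEntropy_localStats (X : ApproxProcess.{u} ℤ A) (W : Finset ℤ) :
    shannonEntropy (X.localStats W) = X.entropyOn W := by
  rw [X.localStats_eq, shannonEntropy_map (X.measurable_sample _)]; rfl

theorem ApproxProcess.entropyOn_mono (X : ApproxProcess.{u} ℤ A) {F G : Finset ℤ} (h : F ⊆ G) :
    X.entropyOn F ≤ X.entropyOn G :=
  fiberEntropy_mono (X.measurable_sample _) (X.measurable_sample _) fun _ _ hxy =>
    (X.sample_eq_iff _ _ _).2 fun w hw => (X.sample_eq_iff _ _ _).1 hxy w (h hw)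

theorem ApproxProcess.increment_nonneg (X : ApproxProcess.{u} ℤ A) (s : ℤ) (F : Finset ℤ) :
    0 ≤ X.increment s F :=
  sub_nonneg.2 (X.entropyOn_mono (Finset.subset_insert _ _))

theorem ApproxProcess.increment_anti (X : ApproxProcess.{u} ℤ A) (s : ℤ) {F G : Finset ℤ}
    (h : F ⊆ G) : X.increment s G ≤ X.increment s F := by
  have hs : Measurable (fun x => X.φ (X.T s x)) :=
    X.measurable_φ.comp (X.measurePreserving s).measurable
  have key := fiberEntropy_submodular (μ := X.μ) hs (X.measurable_sample ((↑) : G → ℤ))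
    (X.measurable_sample ((↑) : F → ℤ))
  have e1 : fiberEntropy X.μ (fun x => (X.φ (X.T s x), X.sample ((↑) : G → ℤ) x,
      X.sample ((↑) : F → ℤ) x)) = X.entropyOn (insert s G) := by
    refine fiberEntropy_congr fun x y => ?_
    simp only [Prod.mk.injEq, X.sample_eq_iff, Finset.forall_mem_insert]
    exact ⟨fun hh => ⟨hh.1, hh.2.1⟩, fun hh => ⟨hh.1, hh.2, fun w hw => hh.2 w (h hw)⟩⟩
  have e2 : fiberEntropy X.μ (fun x => (X.φ (X.T s x), X.sample ((↑) : F → ℤ) x)) =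
      X.entropyOn (insert s F) := by
    refine fiberEntropy_congr fun x y => ?_
    simp only [Prod.mk.injEq, X.sample_eq_iff, Finset.forall_mem_insert]
  have e3 : fiberEntropy X.μ (fun x => (X.sample ((↑) : G → ℤ) x, X.sample ((↑) : F → ℤ) x)) =
      X.entropyOn G := by
    refine fiberEntropy_congr fun x y => ?_
    simp only [Prod.mk.injEq, X.sample_eq_iff]
    exact ⟨fun hh => hh.1, fun hh => ⟨hh, fun w hw => hh w (h hw)⟩⟩
  rw [e1, e2, e3] at key
  have e4 : fiberEntropy X.μ (X.sample ((↑) : F → ℤ)) = X.entropyOn F := rfl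
  unfold ApproxProcess.increment
  linarith

theorem ApproxProcess.entropyOn_image_add {X : ApproxProcess.{u} ℤ A} (hX : X.IsAction)
    (F : Finset ℤ) (g : ℤ) : X.entropyOn (F.image (· + g)) = X.entropyOn F := by
  have h1 : F.image (· + g) = Finset.univ.image (fun i : F => (i : ℤ) + g) := by
    ext z; simp only [Finset.mem_image, Finset.mem_univ, true_and, Subtype.exists, exists_prop]
  rw [h1, ← X.fiberEntropy_sample, ← shannonEntropy_map (X.measurable_sample _),
    ApproxProcess.map_sample_add hX (fun i : F => (i : ℤ)) g,
    shannonEntropy_map (X.measurable_sample _)]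
  rfl

theorem ApproxProcess.increment_shift {X : ApproxProcess.{u} ℤ A} (hX : X.IsAction) (s : ℤ)
    (k : ℕ) : X.increment s (Finset.Icc (s - k) (s - 1)) = X.pastEntropy k := by
  have h1 : Finset.Icc (s - k) (s - 1) = (Finset.Icc (-k : ℤ) (-1)).image (· + s) := by
    rw [Finset.image_add_right_Icc]; congr 1 <;> ring
  have h2 : insert s (Finset.Icc (s - k) (s - 1)) =
      (insert 0 (Finset.Icc (-k : ℤ) (-1))).image (· + s) := by
    rw [Finset.image_insert, ← h1]; simp
  unfold ApproxProcess.pastEntropy ApproxProcess.increment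
  rw [h2, h1, ApproxProcess.entropyOn_image_add hX, ApproxProcess.entropyOn_image_add hX]

theorem ApproxProcess.pastEntropy_nonneg (X : ApproxProcess.{u} ℤ A) (k : ℕ) :
    0 ≤ X.pastEntropy k := X.increment_nonneg _ _

theorem ApproxProcess.rate_le (X : ApproxProcess.{u} ℤ A) (k : ℕ) : X.rate ≤ X.pastEntropy k :=
  ciInf_le ⟨0, by rintro _ ⟨k, rfl⟩; exact X.pastEntropy_nonneg k⟩ k

theorem ApproxProcess.rate_le_increment {X : ApproxProcess.{u} ℤ A} (hX : X.IsAction) (s : ℤ)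
    (F : Finset ℤ) (hF : ∀ t ∈ F, t < s) : X.rate ≤ X.increment s F := by
  obtain ⟨k, hk⟩ : ∃ k : ℕ, F ⊆ Finset.Icc (s - k) (s - 1) := by
    obtain ⟨b, hb⟩ := F.bddBelow
    refine ⟨(s - b).toNat, fun t ht => ?_⟩
    have h1 := hF t ht
    have h2 : b ≤ t := hb ht
    simp only [Finset.mem_Icc]
    omega
  calc X.rate ≤ X.pastEntropy k := X.rate_le k
    _ = _ := (ApproxProcess.increment_shift hX s k).symm
    _ ≤ _ := X.increment_anti s hk

theorem ApproxProcess.card_mul_rate_le {X : ApproxProcess.{u} ℤ A} (hX : X.IsAction)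
    (F : Finset ℤ) : F.card * X.rate ≤ X.entropyOn F := by
  rw [X.entropyOn_eq_sum, ← nsmul_eq_mul]
  exact Finset.card_nsmul_le_sum _ _ _ fun s _ =>
    ApproxProcess.rate_le_increment hX s _ fun t ht => (Finset.mem_filter.1 ht).2

theorem ApproxProcess.increment_le_log (X : ApproxProcess.{u} ℤ A) [Nonempty A] (s : ℤ)
    (F : Finset ℤ) : X.increment s F ≤ Real.log (Nat.card A) := by
  cases nonempty_fintype A
  refine (X.increment_anti s (Finset.empty_subset F)).trans ?_
  rw [ApproxProcess.increment, X.entropyOn_empty, sub_zero, Nat.card_eq_fintype_card]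
  have hs : Measurable (fun x => X.φ (X.T s x)) :=
    X.measurable_φ.comp (X.measurePreserving s).measurable
  refine le_trans (le_of_eq ?_) (fiberEntropy_le_log_card (μ := X.μ) hs)
  refine fiberEntropy_congr fun x y => ?_
  simp [X.sample_eq_iff]

theorem ApproxProcess.entropyOn_le {X : ApproxProcess.{u} ℤ A} [Nonempty A] (hX : X.IsAction)
    (F : Finset ℤ) (k : ℕ) : X.entropyOn F ≤ F.card * X.pastEntropy k +
      (∑ j ∈ Finset.Icc 1 k, ((F.filter (fun s => s - (j : ℤ) ∉ F)).card : ℝ)) *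
        Real.log (Nat.card A) := by
  have hlog : 0 ≤ Real.log (Nat.card A) := Real.log_natCast_nonneg _
  have key : ∀ s ∈ F, X.increment s (F.filter (· < s)) ≤ X.pastEntropy k +
      (∑ j ∈ Finset.Icc 1 k, if s - (j : ℤ) ∉ F then (1 : ℝ) else 0) * Real.log (Nat.card A) := by
    intro s hs
    have hnn : ∀ j ∈ Finset.Icc 1 k, (0 : ℝ) ≤ if s - (j : ℤ) ∉ F then (1 : ℝ) else 0 :=
      fun j _ => by split_ifs <;> norm_num
    by_cases h : ∀ j ∈ Finset.Icc 1 k, s - (j : ℤ) ∈ F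
    · have : Finset.Icc (s - k) (s - 1) ⊆ F.filter (· < s) := by
        intro t ht
        rw [Finset.mem_Icc] at ht
        have := h (s - t).toNat (Finset.mem_Icc.2 (by omega))
        rw [Int.toNat_of_nonneg (by omega), sub_sub_cancel] at this
        exact Finset.mem_filter.2 ⟨this, by omega⟩
      have h1 := X.increment_anti s this
      rw [ApproxProcess.increment_shift hX] at h1
      have := mul_nonneg (Finset.sum_nonneg hnn) hlog
      linarith
    · -- A missing predecessor is paid for by the trivial bound `log |A|`.
      push Not at h
      obtain ⟨j, hj, hj'⟩ := h
      have h1 : (1 : ℝ) ≤ ∑ j ∈ Finset.Icc 1 k, if s - (j : ℤ) ∉ F then (1 : ℝ) else 0 := by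
        refine le_trans ?_ (Finset.single_le_sum hnn hj)
        simp [hj']
      have := X.increment_le_log s (F.filter (· < s))
      have := X.pastEntropy_nonneg k
      nlinarith
  rw [X.entropyOn_eq_sum]
  refine (Finset.sum_le_sum key).trans (le_of_eq ?_)
  rw [Finset.sum_add_distrib, ← Finset.sum_mul, Finset.sum_comm, Finset.sum_const, nsmul_eq_mul]
  simp only [Finset.sum_boole]

/-- Entropy per site converges to the rate along every Følner sequence. -/
theorem ApproxProcess.hasClassicalEntropy_rate {X : ApproxProcess.{u} ℤ A} [Nonempty A]
    (hX : X.IsAction) : HasClassicalEntropy X X.rate := by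
  classical
  intro F hF
  have hpos : ∀ᶠ n in atTop, 0 < ((F n).card : ℝ) := by
    obtain ⟨N, hN⟩ := hF {0} (Finset.singleton_nonempty _) (1 / 2) (by norm_num)
    filter_upwards [eventually_gt_atTop N] with n hn
    have h := hN n hn
    rcases (Nat.cast_nonneg (α := ℝ) (F n).card).eq_or_lt with h0 | h0
    · rw [← h0] at h; norm_num at h
    · exact h0
  simp only [X.shannonEntropy_localStats]
  set l := Real.log (Nat.card A) with hl
  have hlog : 0 ≤ l := Real.log_natCast_nonneg _
  refine tendsto_order.2 ⟨fun c hc => ?_, fun c hc => ?_⟩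
  · filter_upwards [hpos] with n hn
    refine hc.trans_le ((le_div_iff₀ hn).2 ?_)
    rw [mul_comm]
    exact ApproxProcess.card_mul_rate_le hX _
  · obtain ⟨k, hk⟩ := X.exists_pastEntropy_lt hc
    obtain ⟨ε, hε, hεc⟩ : ∃ ε : ℝ, 0 < ε ∧ X.pastEntropy k + k * ε * l < c := by
      refine ⟨(c - X.pastEntropy k) / (k * l + 1) , by
        have : 0 < (k * l + 1) := by positivity
        exact div_pos (by linarith) this, ?_⟩
      have h1 : 0 < (k * l + 1) := by positivity
      have h2 : k * ((c - X.pastEntropy k) / (k * l + 1)) * l < c - X.pastEntropy k := by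
        rw [mul_div_assoc', div_mul_eq_mul_div, div_lt_iff₀ h1]
        nlinarith
      linarith
    have hdefect : ∀ j ∈ Finset.Icc 1 k, ∀ᶠ n in atTop,
        (((F n).filter (fun s => s - (j : ℤ) ∉ F n)).card : ℝ) ≤ ε * (F n).card := by
      intro j _
      obtain ⟨N, hN⟩ := hF {(j : ℤ)} (Finset.singleton_nonempty _) ε hε
      filter_upwards [eventually_gt_atTop N, hpos] with n hn hn0
      have h := (le_div_iff₀ hn0).1 (hN n hn)
      have h' : (1 - ε) * (F n).card ≤ 
          (((F n).filter (fun s => s - (j : ℤ) ∈ F n)).card : ℝ) := by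
        refine h.trans (le_of_eq (congrArg (fun S : Finset ℤ => (S.card : ℝ)) ?_))
        ext s
        simp only [Finset.singleton_add, Finset.mem_inter, Finset.mem_vadd_finset,
          Finset.mem_filter, vadd_eq_add]
        constructor
        · rintro ⟨⟨t, ht, rfl⟩, hs⟩
          exact ⟨hs, by simpa using ht⟩
        · rintro ⟨hs, ht⟩
          exact ⟨⟨_, ht, by ring⟩, hs⟩
      have hsum := Finset.card_filter_add_card_filter_not (s := F n) (fun s => s - (j : ℤ) ∈ F n)
      have hsum' : (((F n).filter (fun s => s - (j : ℤ) ∈ F n)).card : ℝ) +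
        (((F n).filter (fun s => s - (j : ℤ) ∉ F n)).card : ℝ) = (F n).card := by
        exact_mod_cast hsum
      linarith
    filter_upwards [(Finset.eventually_all _).2 hdefect, hpos] with n hn hn0
    rw [div_lt_iff₀ hn0]
    have h1 := ApproxProcess.entropyOn_le hX (F n) k
    have h2 := Finset.sum_le_sum hn
    rw [Finset.sum_const, nsmul_eq_mul, Nat.card_Icc] at h2
    have h3 := mul_le_mul_of_nonneg_right h2 hlog
    simp only [add_tsub_cancel_right] at h3
    have h4 := mul_lt_mul_of_pos_right hεc hn0
    nlinarith

end Classical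

/-! ### Unrolling a permutation along the integers -/

section Rank

variable {m : ℕ}

open Classical in
/-- One cutting point on each cycle of `τ`, namely its least point. -/
def cuts (τ : Sym m) : Finset (Fin m) :=
  Finset.univ.filter fun p => ∀ q, τ.SameCycle p q → p ≤ q

theorem mem_cuts {τ : Sym m} {p : Fin m} : p ∈ cuts τ ↔ ∀ q, τ.SameCycle p q → p ≤ q := by
  simp [cuts]

theorem exists_pow_inv_mem_cuts (τ : Sym m) (p : Fin m) : ∃ k : ℕ, (τ⁻¹ ^ k) p ∈ cuts τ := by
  classical
  obtain ⟨c, hc, hmin⟩ := Finset.exists_min_image (Finset.univ.filter fun q => τ.SameCycle p q) id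
    ⟨p, by simpa using Equiv.Perm.SameCycle.refl τ p⟩
  rw [Finset.mem_filter] at hc
  obtain ⟨k, _, hk⟩ := (Equiv.Perm.sameCycle_inv.2 hc.2).exists_pow_eq'
  refine ⟨k, ?_⟩
  rw [hk, mem_cuts]
  exact fun q hq => hmin q (by simpa using hc.2.trans hq)

/-- The points of a permutation can be listed so that each point that is not a cutting point comes
directly after its predecessor on the cycle. -/
theorem exists_rank (τ : Sym m) : ∃ r : Fin m → ℕ, Function.Injective r ∧ (∀ p, r p < m) ∧
    ∀ p, τ p ∉ cuts τ → r (τ p) = r p + 1 := by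
  classical
  -- `pos p` is the distance from `p` back to the cutting point `base p` of its cycle.
  set pos : Fin m → ℕ := fun p => Nat.find (exists_pow_inv_mem_cuts τ p) with hpos
  set base : Fin m → Fin m := fun p => (τ⁻¹ ^ pos p) p with hbase
  have hstep : ∀ p, τ p ∉ cuts τ → pos (τ p) = pos p + 1 := by
    intro p hp
    have h2 : ∃ k : ℕ, (τ⁻¹ ^ (k + 1)) (τ p) ∈ cuts τ := by
      obtain ⟨k, hk⟩ := exists_pow_inv_mem_cuts τ p
      exact ⟨k, by simpa [pow_succ] using hk⟩
    have := Nat.find_comp_succ (exists_pow_inv_mem_cuts τ (τ p)) h2 (by simpa using hp)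
    refine this.trans ?_
    congr 1
    refine Nat.find_congr' ?_
    intro k
    simp [pow_succ]
  have hbstep : ∀ p, τ p ∉ cuts τ → base (τ p) = base p := by
    intro p hp
    simp only [hbase, hstep p hp]
    simp [pow_succ]
  have hinj : ∀ p q, pos p = pos q → base p = base q → p = q := by
    intro p q h1 h2
    simp only [hbase] at h2
    rw [h1] at h2
    exact (τ⁻¹ ^ pos q).injective h2
  set M := Finset.univ.sup pos + 1 with hM
  have hposM : ∀ p, pos p < M := fun p => Nat.lt_succ_of_le (Finset.le_sup (Finset.mem_univ p))
  set r₀ : Fin m → ℕ := fun p => pos p + M * (base p : ℕ) with hr₀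
  have hr₀inj : Function.Injective r₀ := by
    intro p q h
    have h1 := congrArg (· % M) h
    have h2 := congrArg (· / M) h
    simp only [hr₀, Nat.add_mul_mod_self_left, Nat.mod_eq_of_lt (hposM _)] at h1
    have hM0 : 0 < M := Nat.succ_pos _
    simp only [hr₀, Nat.add_mul_div_left _ _ hM0, Nat.div_eq_of_lt (hposM _), zero_add] at h2
    exact hinj p q h1 (Fin.ext h2)
  have hr₀step : ∀ p, τ p ∉ cuts τ → r₀ (τ p) = r₀ p + 1 := by
    intro p hp
    simp only [hr₀, hstep p hp, hbstep p hp]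
    ring
  -- Compress `r₀` to an initial segment by counting the points below.
  have hlt : ∀ p q, r₀ p < r₀ q → (Finset.univ.filter fun x => r₀ x < r₀ p).card <
      (Finset.univ.filter fun x => r₀ x < r₀ q).card := by
    intro p q h
    refine Finset.card_lt_card ⟨fun x hx => ?_, fun hsub => ?_⟩
    · simp only [Finset.mem_filter, Finset.mem_univ, true_and] at hx ⊢; omega
    · have := hsub (Finset.mem_filter.2 ⟨Finset.mem_univ p, h⟩)
      simp at this
  refine ⟨fun p => (Finset.univ.filter fun q => r₀ q < r₀ p).card, ?_, ?_, ?_⟩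
  · intro p q h
    rcases lt_trichotomy (r₀ p) (r₀ q) with h1 | h1 | h1
    · exact absurd h (hlt p q h1).ne
    · exact hr₀inj h1
    · exact absurd h (hlt q p h1).ne'
  · intro p
    have : (Finset.univ.filter fun q => r₀ q < r₀ p) ⊂ Finset.univ :=
      Finset.filter_ssubset.2 ⟨p, Finset.mem_univ _, lt_irrefl _⟩
    simpa using Finset.card_lt_card this
  · intro p hp
    have : (Finset.univ.filter fun q => r₀ q < r₀ (τ p)) =
        insert p (Finset.univ.filter fun q => r₀ q < r₀ p) := by
      ext q
      simp only [Finset.mem_filter, Finset.mem_univ, true_and, Finset.mem_insert, hr₀step p hp]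
      constructor
      · intro h
        rcases (Nat.lt_succ_iff.1 h).eq_or_lt with h | h
        · exact Or.inl (hr₀inj h)
        · exact Or.inr h
      · rintro (rfl | h) <;> omega
    simp only [this]
    rw [Finset.card_insert_of_notMem (by simp)]

/-- A listing of the points of a permutation as in `exists_rank`. -/
def rank (τ : Sym m) : Fin m → ℕ := (exists_rank τ).choose

theorem rank_injective (τ : Sym m) : Function.Injective (rank τ) := (exists_rank τ).choose_spec.1

theorem rank_lt (τ : Sym m) (p : Fin m) : rank τ p < m := (exists_rank τ).choose_spec.2.1 p

theorem rank_apply {τ : Sym m} {p : Fin m} (h : τ p ∉ cuts τ) : rank τ (τ p) = rank τ p + 1 :=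
  (exists_rank τ).choose_spec.2.2 p h

theorem cuts_nonempty [NeZero m] (τ : Sym m) : (cuts τ).Nonempty := by
  obtain ⟨k, hk⟩ := exists_pow_inv_mem_cuts τ 0
  exact ⟨_, hk⟩

/-- Cycles of length at least `L` contribute at most `m / L` cutting points. -/
theorem ncard_cuts_le (τ : Sym m) (L : ℕ) : L * {p | p ∈ cuts τ}.ncard ≤
    m + L * {p | ∃ j, 1 ≤ j ∧ j < L ∧ (τ ^ j) p = p}.ncard := by
  classical
  have e1 : {p | p ∈ cuts τ}.ncard = (cuts τ).card := by
    rw [← Set.ncard_coe_finset]; rfl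
  have e2 : {p | ∃ j, 1 ≤ j ∧ j < L ∧ (τ ^ j) p = p}.ncard =
      (Finset.univ.filter fun p => ∃ j, 1 ≤ j ∧ j < L ∧ (τ ^ j) p = p).card := by
    rw [← Set.ncard_coe_finset]; congr 1; ext p; simp
  rw [e1, e2]
  set S := Finset.univ.filter fun p => ∃ j, 1 ≤ j ∧ j < L ∧ (τ ^ j) p = p with hS
  have h1 : (cuts τ).card ≤ (cuts τ \ S).card + S.card := by
    exact Finset.card_le_card_sdiff_add_card (s := cuts τ) (t := S)
  have h2 : L * (cuts τ \ S).card ≤ m := by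
    -- The first `L` points after the cutting points of long cycles are all distinct.
    have hinj : Set.InjOn (fun x : ℕ × Fin m => (τ ^ x.1) x.2)
        ((Finset.range L ×ˢ (cuts τ \ S) : Finset (ℕ × Fin m)) : Set (ℕ × Fin m)) := by
      have aux : ∀ (i j : ℕ) (p q : Fin m), i ≤ j → j < L → p ∈ cuts τ → p ∉ S → q ∈ cuts τ →
          (τ ^ i) p = (τ ^ j) q → i = j ∧ p = q := by
        intro i j p q hij hjL hp hpS hq h
        obtain ⟨d, rfl⟩ := Nat.exists_eq_add_of_le hij
        have h' : p = (τ ^ d) q := (τ ^ i).injective (by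
          rw [h, pow_add]; rfl)
        have hsame : τ.SameCycle q p := ⟨d, by rw [h']; simp⟩
        have hpq : p = q := le_antisymm (mem_cuts.1 hp q hsame.symm) (mem_cuts.1 hq p hsame)
        refine ⟨?_, hpq⟩
        by_contra hd
        refine hpS (Finset.mem_filter.2 ⟨Finset.mem_univ _, d, by omega, by omega, ?_⟩)
        rw [← hpq] at h'
        exact h'.symm
      rintro ⟨i, p⟩ hx ⟨j, q⟩ hy h
      simp only [Finset.coe_product, Set.mem_prod, Finset.mem_coe, Finset.mem_range,
        Finset.mem_sdiff] at hx hy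
      rcases le_total i j with hij | hij
      · obtain ⟨a, b⟩ := aux i j p q hij hy.1 hx.2.1 hx.2.2 hy.2.1 h
        rw [a, b]
      · obtain ⟨a, b⟩ := aux j i q p hij hx.1 hy.2.1 hy.2.2 hx.2.1 h.symm
        rw [a, b]
    have := Finset.card_le_card_of_injOn (t := (Finset.univ : Finset (Fin m))) _
      (fun _ _ => Finset.mem_coe.2 (Finset.mem_univ _)) hinj
    simpa using this
  calc L * (cuts τ).card ≤ L * ((cuts τ \ S).card + S.card) := Nat.mul_le_mul_left _ h1
    _ = L * (cuts τ \ S).card + L * S.card := by ring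
    _ ≤ _ := by omega

end Rank

/-! ### Negligible events of a random sofic approximation -/

section Negligible

theorem unif_real_eq {m : ℕ} (s : Set (Fin m)) : (unif m).real s = (s.ncard : ℝ) / m := by
  rw [measureReal_def, uniformOn_univ, Measure.count_apply s.toFinite.measurableSet,
    ENNReal.toReal_div, Set.ncard_def]
  cases h : s.encard <;> simp_all

theorem integral_unif {m : ℕ} [NeZero m] (f : Fin m → ℝ) :
    ∫ p, f p ∂(unif m) = (∑ p, f p) / m := by
  rw [integral_fintype Integrable.of_finite, Finset.sum_div]
  refine Finset.sum_congr rfl fun p _ => ?_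
  rw [unif_real_eq, Set.ncard_singleton, smul_eq_mul]
  simp; ring

theorem ncard_eq_sum_ite {m : ℕ} (P : Fin m → Prop) [DecidablePred P] :
    ({p | P p}.ncard : ℝ) = ∑ p, if P p then (1 : ℝ) else 0 := by
  rw [Finset.sum_boole, ← Set.ncard_coe_finset]
  congr 2; ext p; simp

/-- A family of sets depending on the stage whose probability tends to `0`. -/
def Negligible (K : RandomSoficApprox ℤ)
    (E : ∀ i, Set ((ℤ → Sym (K.m i)) × Fin (K.m i))) : Prop :=
  Tendsto (fun i => ((K.κ i).prod (unif (K.m i))) (E i)) atTop (𝓝 0)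

variable {K : RandomSoficApprox ℤ} {E E' : ∀ i, Set ((ℤ → Sym (K.m i)) × Fin (K.m i))}

theorem Negligible.mono (h : Negligible K E) (hE : ∀ i, E' i ⊆ E i) : Negligible K E' :=
  tendsto_of_tendsto_of_tendsto_of_le_of_le tendsto_const_nhds h (fun _ => zero_le)
    fun i => measure_mono (hE i)

theorem Negligible.union (h : Negligible K E) (h' : Negligible K E') :
    Negligible K (fun i => E i ∪ E' i) := by
  have := Tendsto.add h h'
  rw [add_zero] at this
  exact tendsto_of_tendsto_of_tendsto_of_le_of_le tendsto_const_nhds this (fun _ => zero_le)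
    fun i => measure_union_le _ _

theorem Negligible.biUnion {ι : Type*} (s : Finset ι)
    {E : ι → ∀ i, Set ((ℤ → Sym (K.m i)) × Fin (K.m i))} (h : ∀ a ∈ s, Negligible K (E a)) :
    Negligible K (fun i => ⋃ a ∈ s, E a i) := by
  have := tendsto_finsetSum s h
  rw [Finset.sum_const_zero] at this
  exact tendsto_of_tendsto_of_tendsto_of_le_of_le tendsto_const_nhds this (fun _ => zero_le)
    fun i => measure_biUnion_finset_le _ _

theorem Negligible.real (h : Negligible K E) :
    Tendsto (fun i => ((K.κ i).prod (unif (K.m i))).real (E i)) atTop (𝓝 0) := by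
  exact (ENNReal.tendsto_toReal ENNReal.zero_ne_top).comp h

theorem negligible_of_compl (hE : ∀ i, MeasurableSet (E i))
    (h : Tendsto (fun i => ((K.κ i).prod (unif (K.m i))) (E i)) atTop (𝓝 1)) :
    Negligible K (fun i => (E i)ᶜ) := by
  have := ENNReal.Tendsto.sub (tendsto_const_nhds (x := (1 : ENNReal))) h
    (Or.inl ENNReal.one_ne_top)
  rw [tsub_self] at this
  refine this.congr fun i => ?_
  rw [measure_compl (hE i) (measure_ne_top _ _), measure_univ]

theorem measurable_of_coord {m : ℕ} {β : Type*} [MeasurableSpace β] (a b : ℤ)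
    (G : Sym m × Sym m × Fin m → β) :
    Measurable (fun q : (ℤ → Sym m) × Fin m => G (q.1 a, q.1 b, q.2)) :=
  (measurable_of_finite G).comp (((measurable_pi_apply a).comp measurable_fst).prodMk
    (((measurable_pi_apply b).comp measurable_fst).prodMk measurable_snd))

theorem measurableSet_of_coord {m : ℕ} (a b : ℤ) (G : Sym m × Sym m × Fin m → Prop) :
    MeasurableSet {q : (ℤ → Sym m) × Fin m | G (q.1 a, q.1 b, q.2)} :=
  ((Set.toFinite {z | G z}).measurableSet).preimage (measurable_of_coord a b id)

theorem measurePreserving_apply {m : ℕ} [NeZero m] (κ : Measure (ℤ → Sym m))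
    [IsProbabilityMeasure κ] (g : ℤ) :
    MeasurePreserving (fun q : (ℤ → Sym m) × Fin m => (q.1, q.1 g q.2))
      (κ.prod (unif m)) (κ.prod (unif m)) := by
  exact (MeasurePreserving.id κ).skew_product (g := fun (a : ℤ → Sym m) (p : Fin m) => a g p)
      (measurable_of_coord g g (fun z => z.1 z.2.2)) (ae_of_all _ fun a => map_perm_unif (a g))

theorem Negligible.preimage (hE : ∀ i, MeasurableSet (E i)) (h : Negligible K E) (g : ℤ) :
    Negligible K (fun i => {q | (q.1, q.1 g q.2) ∈ E i}) := by
  refine h.congr fun i => ?_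
  exact ((measurePreserving_apply (K.κ i) g).measure_preimage (hE i).nullMeasurableSet).symm

variable (K)

theorem negligible_add (g h : ℤ) :
    Negligible K (fun _ => {q | q.1 g (q.1 h q.2) ≠ q.1 (g + h) q.2}) := by
  refine negligible_of_compl (fun i => ?_) (K.tendsto_add g h)
  have h3 : Measurable (fun q : (ℤ → Sym (K.m i)) × Fin (K.m i) =>
      (q.1 g (q.1 h q.2), q.1 (g + h) q.2)) :=
    ((measurable_of_coord g h (fun z => z.1 (z.2.1 z.2.2))).prodMk
      (measurable_of_coord (g + h) h (fun z => z.1 z.2.2)))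
  exact h3 (Set.toFinite {z : Fin (K.m i) × Fin (K.m i) | z.1 = z.2}).measurableSet

theorem negligible_eq (g h : ℤ) (hgh : g ≠ h) :
    Negligible K (fun _ => {q | q.1 g q.2 = q.1 h q.2}) := by
  have := negligible_of_compl (fun i => measurableSet_of_coord g h
    (fun z : Sym (K.m i) × Sym (K.m i) × Fin (K.m i) => z.1 z.2.2 ≠ z.2.1 z.2.2))
    (K.tendsto_ne g h hgh)
  simpa [Set.compl_ofPred] using this

theorem negligible_zero : Negligible K (fun _ => {q | q.1 0 q.2 ≠ q.2}) := by
  refine (negligible_add K 0 0).mono fun i q hq => ?_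
  simp only [Set.mem_ofPred_eq, add_zero] at hq ⊢
  exact fun h => hq ((q.1 0).injective h)

/-- The powers of `σ 1` agree with `σ` up to a negligible event. -/
theorem negligible_pow (j : ℕ) : Negligible K (fun _ => {q | ((q.1 1) ^ j) q.2 ≠ q.1 j q.2}) := by
  induction j with
  | zero =>
    refine (negligible_zero K).mono fun i q hq => ?_
    simp only [Set.mem_ofPred_eq, pow_zero, Equiv.Perm.coe_one, id, Nat.cast_zero] at hq ⊢
    exact fun h => hq h.symm
  | succ j ih =>
    refine (ih.union (negligible_add K 1 j)).mono fun i q hq => ?_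
    by_contra hcon
    simp only [Set.mem_union, Set.mem_ofPred_eq, not_or, not_not] at hcon hq
    refine hq ?_
    rw [pow_succ', Equiv.Perm.mul_apply, hcon.1, hcon.2]
    push_cast; rw [add_comm]

theorem negligible_short (L : ℕ) :
    Negligible K (fun _ => {q | ∃ j, 1 ≤ j ∧ j < L ∧ ((q.1 1) ^ j) q.2 = q.2}) := by
  refine (Negligible.biUnion (K := K) (Finset.Ico 1 L) (E := fun j i =>
    (({q | ((q.1 1) ^ j) q.2 ≠ q.1 j q.2} ∪ {q | q.1 0 q.2 ≠ q.2}) ∪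
      {q | q.1 (j : ℤ) q.2 = q.1 0 q.2})) ?_).mono ?_
  · intro j hj
    refine ((negligible_pow K j).union (negligible_zero K)).union (negligible_eq K j 0 ?_)
    have := (Finset.mem_Ico.1 hj).1
    omega
  · rintro i q ⟨j, h1, h2, h3⟩
    refine Set.mem_biUnion (Finset.mem_coe.2 (Finset.mem_Ico.2 ⟨h1, h2⟩)) ?_
    by_contra hcon
    simp only [Set.mem_union, Set.mem_ofPred_eq, not_or, not_not] at hcon
    exact hcon.2 (by rw [← hcon.1.1, h3, hcon.1.2])

theorem measurableSet_cuts {m : ℕ} :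
    MeasurableSet {q : (ℤ → Sym m) × Fin m | q.2 ∈ cuts (q.1 1)} :=
  measurableSet_of_coord 1 1 (fun z => z.2.2 ∈ cuts z.1)

theorem prod_unif_real {m : ℕ} [NeZero m] (κ : Measure (ℤ → Sym m)) [IsProbabilityMeasure κ]
    {E : Set ((ℤ → Sym m) × Fin m)} (hE : MeasurableSet E) :
    (κ.prod (unif m)).real E = ∫ σ, ({p | (σ, p) ∈ E}.ncard : ℝ) / m ∂κ := by
  rw [measureReal_def, Measure.prod_apply hE, integral_eq_lintegral_of_nonneg_ae
    (ae_of_all _ fun _ => by positivity)]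
  · congr 1
    refine lintegral_congr fun σ => ?_
    rw [← unif_real_eq, ofReal_measureReal]
    rfl
  · have := (measurable_measure_prodMk_left (ν := unif m)
      hE).ennreal_toReal.aestronglyMeasurable (μ := κ)
    refine this.congr (ae_of_all _ fun σ => ?_)
    exact unif_real_eq _

theorem integrable_ncard {m : ℕ} [NeZero m] (κ : Measure (ℤ → Sym m)) [IsProbabilityMeasure κ]
    {E : Set ((ℤ → Sym m) × Fin m)} (hE : MeasurableSet E) :
    Integrable (fun σ => ({p | (σ, p) ∈ E}.ncard : ℝ) / m) κ := by
  have := (measurable_measure_prodMk_left (ν := unif m) hE).ennreal_toReal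
  have h2 : (fun σ => ((unif m) (Prod.mk σ ⁻¹' E)).toReal) =
    fun σ => ({p | (σ, p) ∈ E}.ncard : ℝ) / m := by
    funext σ; exact unif_real_eq _
  rw [h2] at this
  refine Integrable.of_bound this.aestronglyMeasurable 1 (ae_of_all _ fun σ => ?_)
  rw [← unif_real_eq, Real.norm_of_nonneg measureReal_nonneg]
  exact measureReal_le_one

/-- The cutting points of `σ 1` have vanishing density. -/
theorem negligible_cuts : Negligible K (fun _ => {q | q.2 ∈ cuts (q.1 1)}) := by
  refine ENNReal.tendsto_nhds_zero.2 fun ε hε => ?_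
  obtain ⟨L, hL0, hL⟩ := ENNReal.exists_nat_pos_inv_mul_lt (a := 1) (b := ε / 2)
    ENNReal.one_ne_top (ENNReal.half_pos hε.ne').ne'
  rw [mul_one] at hL
  have := ENNReal.tendsto_nhds_zero.1 (negligible_short K L) (ε / 2) (ENNReal.half_pos hε.ne')
  filter_upwards [this] with i hi
  have hm : (0 : ℝ) < K.m i := by exact_mod_cast Nat.pos_of_ne_zero (NeZero.ne (K.m i))
  have hL' : (0 : ℝ) < L := by exact_mod_cast hL0
  have hLtop : (L : ENNReal)⁻¹ ≠ ⊤ := by simp [hL0.ne']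
  set S : Set ((ℤ → Sym (K.m i)) × Fin (K.m i)) :=
    {q | ∃ j, 1 ≤ j ∧ j < L ∧ ((q.1 1) ^ j) q.2 = q.2} with hS
  have hSm : MeasurableSet S :=
    measurableSet_of_coord 1 1 (fun z : Sym (K.m i) × Sym (K.m i) × Fin (K.m i) =>
      ∃ j, 1 ≤ j ∧ j < L ∧ (z.1 ^ j) z.2.2 = z.2.2)
  have hpoint : ∀ σ : ℤ → Sym (K.m i), unif (K.m i) {p | p ∈ cuts (σ 1)} ≤
      (L : ENNReal)⁻¹ + unif (K.m i) (Prod.mk σ ⁻¹' S) := by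
    intro σ
    have e1 := unif_real_eq {p | p ∈ cuts (σ 1)}
    have e2 := unif_real_eq (Prod.mk σ ⁻¹' S)
    rw [measureReal_def] at e1 e2
    rw [← ENNReal.toReal_le_toReal (measure_ne_top _ _)
      (ENNReal.add_ne_top.2 ⟨hLtop, measure_ne_top _ _⟩),
      ENNReal.toReal_add hLtop (measure_ne_top _ _), e1, e2, ENNReal.toReal_inv,
      ENNReal.toReal_natCast, div_le_iff₀ hm, add_mul, div_mul_cancel₀ _ hm.ne']
    have hc : (L : ℝ) * {p | p ∈ cuts (σ 1)}.ncard ≤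
        K.m i + L * (Prod.mk σ ⁻¹' S).ncard := by
      exact_mod_cast ncard_cuts_le (σ 1) L
    refine le_of_mul_le_mul_left (hc.trans (le_of_eq ?_)) hL'
    field_simp
  refine le_trans ?_ ((add_le_add hL.le hi).trans (ENNReal.add_halves ε).le)
  rw [Measure.prod_apply measurableSet_cuts, Measure.prod_apply hSm]
  refine (lintegral_mono hpoint).trans (le_of_eq ?_)
  rw [lintegral_add_left measurable_const]
  simp

/-- The number of points tends to infinity, since there is always a cutting point. -/
theorem tendsto_inv_m : Tendsto (fun i => (1 : ℝ) / K.m i) atTop (𝓝 0) := by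
  refine squeeze_zero (fun _ => by positivity) (fun i => ?_) (negligible_cuts K).real
  rw [prod_unif_real _ measurableSet_cuts]
  have : ∫ _, (1 : ℝ) / K.m i ∂(K.κ i) = 1 / K.m i := by simp
  rw [← this]
  refine integral_mono (integrable_const _) (integrable_ncard _ measurableSet_cuts) fun σ => ?_
  have : 1 ≤ {p | p ∈ cuts (σ 1)}.ncard := by
    rw [Nat.one_le_iff_ne_zero, ← Nat.pos_iff_ne_zero, Set.ncard_pos]
    exact cuts_nonempty _
  have h2 : (1 : ℝ) ≤ ({p | p ∈ cuts (σ 1)}.ncard : ℝ) := by exact_mod_cast this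
  exact div_le_div_of_nonneg_right h2 (by positivity)

/-- After relabelling the points by their rank, a sofic approximation of the integers is close to
the translation of an interval. -/
theorem negligible_rank (w : ℤ) :
    Negligible K (fun _ => {q | (rank (q.1 1) (q.1 w q.2) : ℤ) ≠ rank (q.1 1) q.2 + w}) := by
  have step : ∀ w : ℤ, Negligible K (fun i => ({q | q.1 1 (q.1 w q.2) ≠ q.1 (1 + w) q.2} :
      Set ((ℤ → Sym (K.m i)) × Fin (K.m i))) ∪ {q | q.1 1 (q.1 w q.2) ∈ cuts (q.1 1)}) := by
    intro w
    refine (negligible_add K 1 w).union ?_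
    exact Negligible.preimage
      (fun i => measurableSet_of_coord 1 1 (fun z => z.1 z.2.2 ∈ cuts z.1))
      (Negligible.preimage (fun i => measurableSet_cuts) (negligible_cuts K) 1) w
  have good : ∀ {m : ℕ} (w : ℤ) (q : (ℤ → Sym m) × Fin m), q ∉ ({q | q.1 1 (q.1 w q.2) ≠
      q.1 (1 + w) q.2} : Set ((ℤ → Sym m) × Fin m)) ∪ {q | q.1 1 (q.1 w q.2) ∈ cuts (q.1 1)} →
      rank (q.1 1) (q.1 (1 + w) q.2) = rank (q.1 1) (q.1 w q.2) + 1 := by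
    intro m w q hq
    simp only [Set.mem_union, Set.mem_ofPred_eq, not_or, not_not] at hq
    rw [← hq.1, rank_apply hq.2]
  induction w using Int.induction_on with
  | zero =>
    refine (negligible_zero K).mono fun i q hq hcon => hq ?_
    simp [hcon]
  | succ j ih =>
    refine (ih.union (step j)).mono fun i q hq => ?_
    by_contra hcon
    rw [Set.mem_union, not_or] at hcon
    have h1 := good _ q hcon.2
    have h2 := hcon.1
    simp only [Set.mem_ofPred_eq, not_not] at h2
    refine hq ?_
    rw [add_comm (j : ℤ) 1, h1]
    push_cast
    rw [h2]; ring
  | pred j ih =>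
    refine (ih.union (step (-j - 1))).mono fun i q hq => ?_
    by_contra hcon
    rw [Set.mem_union, not_or] at hcon
    have h1 := good _ q hcon.2
    have h2 := hcon.1
    simp only [Set.mem_ofPred_eq, not_not] at h2
    refine hq ?_
    rw [show (1 : ℤ) + (-j - 1) = -j by ring] at h1
    rw [h1] at h2
    push_cast at h2
    linarith

/-- The points `p` at which `σ` moves `p` by the translation by `w`, in terms of ranks, for
all `w ∈ W`. -/
def Tracks {m : ℕ} (W : Finset ℤ) (σ : ℤ → Sym m) (p : Fin m) : Prop :=
  ∀ w ∈ W, (rank (σ 1) (σ w p) : ℤ) = rank (σ 1) p + w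

theorem negligible_not_tracks (W : Finset ℤ) :
    Negligible K (fun _ => {q | ¬ Tracks W q.1 q.2}) := by
  refine (Negligible.biUnion (K := K) W (fun w _ => negligible_rank K w)).mono fun i q hq => ?_
  simp only [Tracks, Set.mem_ofPred_eq, not_forall] at hq
  obtain ⟨w, hw, h⟩ := hq
  exact Set.mem_biUnion (Finset.mem_coe.2 hw) h

theorem measurableSet_not_tracks {m : ℕ} (W : Finset ℤ) :
    MeasurableSet {q : (ℤ → Sym m) × Fin m | ¬ Tracks W q.1 q.2} := by
  have : {q : (ℤ → Sym m) × Fin m | ¬ Tracks W q.1 q.2} =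
      (⋂ w ∈ W, {q | (rank (q.1 1) (q.1 w q.2) : ℤ) = rank (q.1 1) q.2 + w})ᶜ := by
    ext q; simp [Tracks]
  rw [this]
  exact (Finset.measurableSet_biInter _ fun w _ => measurableSet_of_coord 1 w
    (fun z => (rank z.1 (z.2.1 z.2.2) : ℤ) = rank z.1 z.2.2 + w)).compl

end Negligible

/-! ### Coding a configuration by its past -/

section Coding

/-- A product of transition weights, each looking only at points of smaller rank, has total mass
at most one. -/
theorem sum_prod_transition_le_one {I A : Type*} [Fintype I] [DecidableEq I] [Fintype A]
    [Nonempty A] (r : I → ℕ) (hr : Function.Injective r) (k : I → (I → A) → ℝ)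
    (hnn : ∀ p ψ, 0 ≤ k p ψ) (hsum : ∀ p ψ, ∑ a, k p (Function.update ψ p a) ≤ 1)
    (hdep : ∀ p q ψ a, r p < r q → k p (Function.update ψ q a) = k p ψ) :
    ∑ ψ : I → A, ∏ p, k p ψ ≤ 1 := by
  have hc : (0 : ℝ) < Fintype.card A := by exact_mod_cast Fintype.card_pos
  -- Refreshing one coordinate permutes the pairs of a configuration and a letter.
  have resample : ∀ (q : I) (F : (I → A) → ℝ),
      ∑ ψ, ∑ a, F (Function.update ψ q a) = Fintype.card A * ∑ ψ, F ψ := by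
    intro q F
    have hinv : Function.Involutive
        (fun z : (I → A) × A => (Function.update z.1 q z.2, z.1 q)) := by
      rintro ⟨ψ, a⟩
      simp
    have := Equiv.sum_comp hinv.toPerm (fun z : (I → A) × A => F z.1)
    rw [Fintype.sum_prod_type, Fintype.sum_prod_type] at this
    refine this.trans ?_
    simp [Finset.mul_sum]
  have key : ∀ S : Finset I, ∑ ψ : I → A, ∏ p ∈ S, k p ψ ≤
      (Fintype.card A : ℝ) ^ (Fintype.card I) / (Fintype.card A : ℝ) ^ S.card := by
    intro S
    induction S using Finset.induction_on_max_value r with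
    | empty => simp
    | insert q S hq hmax ih =>
      have h1 := resample q (fun ψ => ∏ p ∈ insert q S, k p ψ)
      have h2 : ∀ ψ, ∑ a, ∏ p ∈ insert q S, k p (Function.update ψ q a) ≤ ∏ p ∈ S, k p ψ := by
        intro ψ
        have : ∀ a, ∏ p ∈ insert q S, k p (Function.update ψ q a) =
            k q (Function.update ψ q a) * ∏ p ∈ S, k p ψ := by
          intro a
          rw [Finset.prod_insert hq]
          congr 1
          refine Finset.prod_congr rfl fun p hp => hdep p q ψ a ?_
          exact lt_of_le_of_ne (hmax p hp) fun h => hq (hr h ▸ hp)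
        rw [Finset.sum_congr rfl fun a _ => this a, ← Finset.sum_mul]
        exact mul_le_of_le_one_left (Finset.prod_nonneg fun p _ => hnn p ψ) (hsum q ψ)
      have h3 := (h1.symm.le.trans (Finset.sum_le_sum fun ψ _ => h2 ψ)).trans ih
      rw [Finset.card_insert_of_notMem hq, pow_succ, ← div_div, le_div_iff₀ hc]
      linarith
  have := key Finset.univ
  rwa [Finset.card_univ, div_self (by positivity)] at this

variable {A : Type w} [Fintype A] [Nonempty A]

/-- A subprobability kernel for the letter at time `0` given the letters at the times in a set of
negative times, applied along the points of `Fin m` that `σ` moves as a translation, yields a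
subprobability on configurations. -/
theorem sum_exp_neg_code_le_one (W : Finset ℤ) (hW0 : ∀ w ∈ W, w ≤ 0) (z : W)
    (hz : (z : ℤ) = 0) (ℓ : (W → A) → ℝ) (hℓ : ∀ a, 0 ≤ ℓ a)
    (hsum : ∀ a, ∑ y, Real.exp (-ℓ (Function.update a z y)) ≤ 1)
    {m : ℕ} (σ : ℤ → Sym m) :
    ∑ ψ : Fin m → A, Real.exp (-(∑ p, ℓ (fun w => ψ (σ w p)) +
      {p | ¬ Tracks W σ p}.ncard * Real.log (Fintype.card A))) ≤ 1 := by
  classical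
  have hc : (0 : ℝ) < Fintype.card A := by exact_mod_cast Fintype.card_pos
  set k : Fin m → (Fin m → A) → ℝ := fun p ψ =>
    if Tracks W σ p then Real.exp (-ℓ (fun w => ψ (σ w p))) else (Fintype.card A : ℝ)⁻¹ with hk
  refine le_trans ?_ (sum_prod_transition_le_one (rank (σ 1)) (rank_injective _) k ?_ ?_ ?_)
  · refine Finset.sum_le_sum fun ψ _ => ?_
    have e : ({p | ¬ Tracks W σ p}.ncard : ℝ) * Real.log (Fintype.card A) =
        ∑ p, if ¬ Tracks W σ p then Real.log (Fintype.card A) else 0 := by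
      rw [← Finset.sum_filter, Finset.sum_const, nsmul_eq_mul, ← Set.ncard_coe_finset]
      congr 3; ext p; simp
    rw [e, ← Finset.sum_add_distrib, ← Finset.sum_neg_distrib, Real.exp_sum]
    refine Finset.prod_le_prod (fun _ _ => (Real.exp_pos _).le) fun p _ => ?_
    simp only [hk]
    by_cases hp : Tracks W σ p
    · simp [hp]
    · simp only [hp, not_false_eq_true, if_true, if_false, neg_add, Real.exp_add]
      rw [Real.exp_neg (Real.log _), Real.exp_log hc]
      refine mul_le_of_le_one_left (by positivity) (Real.exp_le_one_iff.2 ?_)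
      linarith [hℓ (fun w => ψ (σ w p))]
  · intro p ψ
    simp only [hk]
    split_ifs
    · exact (Real.exp_pos _).le
    · positivity
  · intro p ψ
    simp only [hk]
    by_cases hp : Tracks W σ p
    · simp only [hp, if_true]
      refine le_trans (le_of_eq ?_) (hsum (fun w => ψ (σ w p)))
      refine Finset.sum_congr rfl fun y _ => ?_
      congr 3
      funext w
      have hw := hp w w.2
      by_cases h0 : w = z
      · subst h0
        have : σ w p = p := rank_injective (σ 1) (by rw [hz] at hw ⊢; simpa using hw)
        simp [this]
      · have h0' : (w : ℤ) ≠ 0 := fun h => h0 (Subtype.ext (h.trans hz.symm))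
        have : σ w p ≠ p := fun h => h0' (by rw [h] at hw; linarith)
        rw [Function.update_of_ne this, Function.update_of_ne h0]
    · simp [hp]
  · intro p q ψ a hpq
    simp only [hk]
    by_cases hp : Tracks W σ p
    · simp only [hp, if_true]
      congr 3
      funext w
      have hw := hp w w.2
      refine Function.update_of_ne (fun h => ?_) _ _
      have := hW0 w w.2
      rw [h] at hw
      omega
    · simp [hp]

variable [MeasurableSpace A] [DiscreteMeasurableSpace A]

/-- There is a code for configurations whose mean length per site, measured on the statistics of
the process, is arbitrarily close to the entropy rate. The lengths are the logarithms of the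
conditional probabilities given a long past, mixed with the uniform distribution to keep them
bounded. -/
theorem exists_code (X : ApproxProcess.{u} ℤ A) {c : ℝ} (hc : X.rate < c) :
    ∃ (W : Finset ℤ) (ℓ : (W → A) → ℝ), (∀ a, 0 ≤ ℓ a) ∧
      ∫ x, ℓ (X.sample ((↑) : W → ℤ) x) ∂X.μ < c ∧
      ∀ (m : ℕ) (σ : ℤ → Sym m), ∑ ψ : Fin m → A, Real.exp (-(∑ p, ℓ (fun w => ψ (σ w p)) +
        {p | ¬ Tracks W σ p}.ncard * Real.log (Fintype.card A))) ≤ 1 := by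
  obtain ⟨k, hk⟩ := X.exists_pastEntropy_lt hc
  obtain ⟨δ, hδ0, hδ1, hδ⟩ : ∃ δ : ℝ, 0 < δ ∧ δ < 1 ∧ X.pastEntropy k - Real.log (1 - δ) < c := by
    have h1 : Tendsto (fun δ : ℝ => X.pastEntropy k - Real.log (1 - δ)) (𝓝[>] 0)
        (𝓝 (X.pastEntropy k)) := by
      have : ContinuousAt (fun δ : ℝ => X.pastEntropy k - Real.log (1 - δ)) 0 := by
        refine continuousAt_const.sub (ContinuousAt.log (by fun_prop) (by norm_num))
      have := this.tendsto
      simp only [sub_zero, Real.log_one] at this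
      exact this.mono_left nhdsWithin_le_nhds
    obtain ⟨δ, h, h'⟩ := ((h1.eventually (gt_mem_nhds hk)).and
      (Ioo_mem_nhdsGT (show (0 : ℝ) < 1 by norm_num))).exists
    exact ⟨δ, h'.1, h'.2, h⟩
  classical
  have hA : (0 : ℝ) < Fintype.card A := by exact_mod_cast Fintype.card_pos
  set P := Finset.Icc (-k : ℤ) (-1) with hPdef
  have hP : ∀ w ∈ P, w < 0 := fun w hw => by
    have := (Finset.mem_Icc.1 hw).2; omega
  set W : Finset ℤ := insert 0 P with hW
  have hW0 : ∀ w ∈ W, w ≤ 0 := fun w hw => by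
    rcases Finset.mem_insert.1 hw with rfl | h
    · exact le_rfl
    · exact (hP w h).le
  set z : W := ⟨0, Finset.mem_insert_self _ _⟩ with hz
  set s : X.Ω → W → A := X.sample ((↑) : W → ℤ) with hs
  have hsm : Measurable s := X.measurable_sample _
  -- `N a / D a` is the conditional probability of the present letter of `a` given its past,
  -- with the junk value `0` if the past has probability zero; then the sum over the present
  -- letter is `0` instead of `1`, which is harmless since only subprobabilities are needed.
  set N : (W → A) → ℝ := fun a => X.μ.real {x | s x = a} with hN
  set D : (W → A) → ℝ := fun a => X.μ.real {x | ∀ w, w ≠ z → s x w = a w} with hD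
  have hNnn : ∀ a, 0 ≤ N a := fun _ => measureReal_nonneg
  have hDnn : ∀ a, 0 ≤ D a := fun _ => measureReal_nonneg
  have hND : ∀ a, N a ≤ D a := fun a => measureReal_mono fun x hx w _ => congrFun hx w
  have hDup : ∀ a y, D (Function.update a z y) = D a := by
    intro a y
    simp only [hD]
    congr 1
    ext x
    refine forall₂_congr fun w hw => ?_
    rw [Function.update_of_ne hw]
  have hNsum : ∀ a, ∑ y, N (Function.update a z y) = D a := by
    intro a
    have := measureReal_biUnion_finset (μ := X.μ) (s := Finset.univ)
      (f := fun y : A => {x | s x = Function.update a z y})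
      (by
        intro y _ y' _ hyy
        refine Set.disjoint_left.2 fun x (hx : s x = _) (hx' : s x = _) => hyy ?_
        have := congrFun (hx.symm.trans hx') z
        simpa using this)
      (fun y _ => hsm (MeasurableSet.singleton _))
    rw [← this]
    simp only [hD]
    congr 1
    ext x
    simp only [Finset.mem_univ, Set.iUnion_true, Set.mem_iUnion, Set.mem_ofPred_eq]
    constructor
    · rintro ⟨y, hy⟩ w hw
      rw [hy, Function.update_of_ne hw]
    · intro h
      refine ⟨s x z, ?_⟩
      funext w
      by_cases hw : w = z
      · rw [hw, Function.update_self]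
      · rw [Function.update_of_ne hw, h w hw]
  set Q : (W → A) → ℝ := fun a => (1 - δ) * (N a / D a) + δ / Fintype.card A with hQ
  have hNDle : ∀ a, N a / D a ≤ 1 := fun a => div_le_one_of_le₀ (hND a) (hDnn a)
  have hND0 : ∀ a, 0 ≤ N a / D a := fun a => div_nonneg (hNnn a) (hDnn a)
  have hQpos : ∀ a, 0 < Q a := fun a => by
    have := mul_nonneg (by linarith : 0 ≤ 1 - δ) (hND0 a)
    have : 0 < δ / Fintype.card A := by positivity
    simp only [hQ]; linarith
  have hQle : ∀ a, Q a ≤ 1 := fun a => by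
    have h1 : (1 - δ) * (N a / D a) ≤ (1 - δ) * 1 :=
      mul_le_mul_of_nonneg_left (hNDle a) (by linarith)
    have h2 : δ / Fintype.card A ≤ δ := div_le_self hδ0.le (by exact_mod_cast Fintype.card_pos)
    simp only [hQ]; linarith
  refine ⟨W, fun a => -Real.log (Q a),
    fun a => neg_nonneg.2 (Real.log_nonpos (hQpos a).le (hQle a)),
    ?_, fun m σ => sum_exp_neg_code_le_one W hW0 z rfl _
      (fun a => neg_nonneg.2 (Real.log_nonpos (hQpos a).le (hQle a))) (fun a => ?_) σ⟩
  · refine lt_of_le_of_lt ?_ hδ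
    have eN : ∫ x, -Real.log (N (s x)) ∂X.μ = X.entropyOn W := rfl
    have eD : ∫ x, -Real.log (D (s x)) ∂X.μ = X.entropyOn P := by
      unfold ApproxProcess.entropyOn fiberEntropy
      congr with x
      simp only [hD]
      congr 3
      ext y
      rw [Set.mem_ofPred_eq, Set.mem_ofPred_eq, X.sample_eq_iff]
      constructor
      · intro h w hw
        exact h ⟨w, Finset.mem_insert_of_mem hw⟩ fun h0 => (hP w hw).ne (congrArg Subtype.val h0)
      · rintro h ⟨w, hw⟩ hw0
        exact h w ((Finset.mem_insert.1 hw).resolve_left fun h0 => hw0 (Subtype.ext h0))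
    have : X.pastEntropy k - Real.log (1 - δ) =
        ∫ x, ((-Real.log (N (s x)) - -Real.log (D (s x))) - Real.log (1 - δ)) ∂X.μ := by
      rw [integral_sub, integral_sub, eN, eD]
      · simp [ApproxProcess.pastEntropy, ApproxProcess.increment, hW, hPdef]
      · exact integrable_comp_of_finite hsm (fun a => -Real.log (N a))
      · exact integrable_comp_of_finite hsm (fun a => -Real.log (D a))
      · exact integrable_comp_of_finite hsm (fun a => -Real.log (N a) - -Real.log (D a))
      · exact integrable_const _
    rw [this]
    refine integral_mono_ae (integrable_comp_of_finite hsm (fun a => -Real.log (Q a)))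
      (integrable_comp_of_finite hsm
        (fun a => (-Real.log (N a) - -Real.log (D a)) - Real.log (1 - δ))) ?_
    filter_upwards [ae_fiber_pos (μ := X.μ) s] with x hx
    have hNx : 0 < N (s x) := hx
    have hDx : 0 < D (s x) := hNx.trans_le (hND _)
    have hδ' : 0 < 1 - δ := by linarith
    have h1 : (1 - δ) * (N (s x) / D (s x)) ≤ Q (s x) := by
      have : 0 ≤ δ / Fintype.card A := by positivity
      simp only [hQ]; linarith
    have h2 := Real.log_le_log (by positivity) h1
    rw [Real.log_mul hδ'.ne' (by positivity), Real.log_div hNx.ne' hDx.ne'] at h2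
    linarith
  · simp only [neg_neg]
    rw [Finset.sum_congr rfl fun y _ => Real.exp_log (hQpos _)]
    simp only [hQ, hDup]
    rw [Finset.sum_add_distrib, ← Finset.mul_sum, ← Finset.sum_div, hNsum, Finset.sum_const,
      nsmul_eq_mul, Finset.card_univ, mul_div_cancel₀ _ hA.ne']
    have h1 : (1 - δ) * (D a / D a) ≤ (1 - δ) * 1 :=
      mul_le_mul_of_nonneg_left (div_self_le_one _) (by linarith)
    linarith

end Coding

/-! ### Upper bounds by the entropy rate -/

section UpperBounds

theorem tvDist_eq_sum {S : Type*} [Fintype S] [MeasurableSpace S] (ν ν' : Measure S) :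
    tvDist ν ν' = (1 / 2) * ∑ a, |ν.real {a} - ν'.real {a}| := by
  rw [tvDist, tsum_fintype]

theorem abs_integral_sub_le {S : Type*} [Fintype S] [MeasurableSpace S] [MeasurableSingletonClass S]
    (ν ν' : Measure S) [IsFiniteMeasure ν] [IsFiniteMeasure ν'] (ℓ : S → ℝ) {B : ℝ}
    (hB : ∀ a, |ℓ a| ≤ B) : |∫ a, ℓ a ∂ν - ∫ a, ℓ a ∂ν'| ≤ 2 * B * tvDist ν ν' := by
  rw [integral_fintype Integrable.of_finite, integral_fintype Integrable.of_finite,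
    ← Finset.sum_sub_distrib, tvDist_eq_sum]
  calc |∑ a, (ν.real {a} • ℓ a - ν'.real {a} • ℓ a)|
      ≤ ∑ a, |ν.real {a} • ℓ a - ν'.real {a} • ℓ a| := Finset.abs_sum_le_sum_abs _ _
    _ ≤ ∑ a, B * |ν.real {a} - ν'.real {a}| := by
        refine Finset.sum_le_sum fun a _ => ?_
        rw [smul_eq_mul, smul_eq_mul, ← sub_mul, abs_mul, mul_comm]
        exact mul_le_mul_of_nonneg_right (hB a) (abs_nonneg _)
    _ = _ := by rw [← Finset.mul_sum]; ring

theorem exists_abs_le {S : Type*} [Fintype S] (ℓ : S → ℝ) : ∃ B : ℝ, 0 ≤ B ∧ ∀ a, |ℓ a| ≤ B :=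
  ⟨∑ a, |ℓ a|, Finset.sum_nonneg fun _ _ => abs_nonneg _,
    fun a => Finset.single_le_sum (f := fun a => |ℓ a|) (fun _ _ => abs_nonneg _)
      (Finset.mem_univ a)⟩


/-- The proportion of points at which `σ` does not act as a translation of the ranks. -/
def offTrack {m : ℕ} (W : Finset ℤ) (σ : ℤ → Sym m) : ℝ :=
  ({p | ¬ Tracks W σ p}.ncard : ℝ) / m

theorem offTrack_nonneg {m : ℕ} (W : Finset ℤ) (σ : ℤ → Sym m) : 0 ≤ offTrack W σ := by
  unfold offTrack; positivity

theorem integrable_offTrack {m : ℕ} [NeZero m] (κ : Measure (ℤ → Sym m)) [IsProbabilityMeasure κ]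
    (W : Finset ℤ) : Integrable (offTrack W) κ := by
  have h := integrable_ncard κ (measurableSet_not_tracks (m := m) W)
  exact h

theorem integral_offTrack {m : ℕ} [NeZero m] (κ : Measure (ℤ → Sym m)) [IsProbabilityMeasure κ]
    (W : Finset ℤ) :
    ∫ σ, offTrack W σ ∂κ = (κ.prod (unif m)).real {q | ¬ Tracks W q.1 q.2} := by
  rw [prod_unif_real κ (measurableSet_not_tracks W)]
  rfl

theorem tendsto_integral_offTrack (K : RandomSoficApprox ℤ) (W : Finset ℤ) :
    Tendsto (fun i => ∫ σ, offTrack W σ ∂(K.κ i)) atTop (𝓝 0) := by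
  simp only [integral_offTrack]
  exact (negligible_not_tracks K W).real

/-- A code bounds the entropy of any law on configurations. -/
theorem shannonEntropy_le_integral {S : Type*} [Fintype S] [MeasurableSpace S]
    [MeasurableSingletonClass S] (ν : Measure S) [IsProbabilityMeasure ν] (f : S → ℝ)
    (hf : ∑ s, Real.exp (-f s) ≤ 1) : shannonEntropy ν ≤ ∫ s, f s ∂ν := by
  rw [shannonEntropy, tsum_fintype, integral_fintype Integrable.of_finite]
  have h1 : ∑ s, ν.real {s} = 1 := by
    simp
  refine (sum_negMulLog_le Finset.univ (fun s => ν.real {s}) (fun s => Real.exp (-f s))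
    (fun _ _ => measureReal_nonneg) (fun _ _ => (Real.exp_pos _).le)
    (fun _ _ _ => (Real.exp_pos _).ne') (hf.trans h1.ge)).trans (le_of_eq ?_)
  simp

theorem shannonEntropy_nonneg {S : Type*} [MeasurableSpace S] (ν : Measure S)
    [IsProbabilityMeasure ν] : 0 ≤ shannonEntropy ν :=
  tsum_nonneg fun _ => Real.negMulLog_nonneg measureReal_nonneg measureReal_le_one

variable {A : Type w} [MeasurableSpace A]

theorem log_numModels_nonneg {m : ℕ} (X : ApproxProcess.{u} ℤ A) (W : Finset ℤ) (ε : ℝ)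
    (σ : ℤ → Sym m) : 0 ≤ Real.log (numModels X W ε σ) := Real.log_natCast_nonneg _

theorem measurable_numModels [Finite A] {m : ℕ} (X : ApproxProcess.{u} ℤ A) (W : Finset ℤ)
    (ε : ℝ) :
    Measurable (fun σ : ℤ → Sym m => numModels X W ε σ) := by
  have h : (fun σ : ℤ → Sym m => numModels X W ε σ) =
      (fun τ : W → Sym m => {ψ : Fin m → A | tvDist (X.localStats W)
        ((unif m).map (fun p (w : W) => ψ (τ w p))) < ε}.ncard) ∘ fun σ w => σ w := rfl
  rw [h]
  exact (measurable_of_finite _).comp (measurable_pi_lambda _ fun w => measurable_pi_apply _)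

variable [Fintype A]

theorem numModels_le {m : ℕ} (X : ApproxProcess.{u} ℤ A) (W : Finset ℤ) (ε : ℝ)
    (σ : ℤ → Sym m) :
    numModels X W ε σ ≤ Fintype.card A ^ m := by
  refine (Set.ncard_le_ncard (Set.subset_univ _) Set.finite_univ).trans (le_of_eq ?_)
  rw [Set.ncard_univ, Nat.card_eq_fintype_card]; simp

theorem integrable_log_numModels {m : ℕ} (X : ApproxProcess.{u} ℤ A) (W : Finset ℤ) (ε : ℝ)
    (κ : Measure (ℤ → Sym m)) [IsFiniteMeasure κ] :
    Integrable (fun σ => Real.log (numModels X W ε σ)) κ := by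
  refine Integrable.of_bound ((Measurable.of_discrete (f := fun n : ℕ => Real.log n)).comp
    (measurable_numModels X W ε)).aestronglyMeasurable (Real.log ((Fintype.card A ^ m : ℕ) : ℝ))
    (ae_of_all _ fun σ => ?_)
  rw [Real.norm_of_nonneg (log_numModels_nonneg X W ε σ)]
  rcases Nat.eq_zero_or_pos (numModels X W ε σ) with h | h
  · rw [h]; simpa using Real.log_natCast_nonneg (Fintype.card A ^ m)
  · exact Real.log_le_log (by exact_mod_cast h) (by exact_mod_cast numModels_le X W ε σ)

variable [DiscreteMeasurableSpace A]

instance (X : ApproxProcess.{u} ℤ A) (W : Finset ℤ) : IsProbabilityMeasure (X.localStats W) :=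
  Measure.isProbabilityMeasure_map (X.measurable_sample _).aemeasurable

theorem integral_localStats (X : ApproxProcess.{u} ℤ A) (W : Finset ℤ) (ℓ : (W → A) → ℝ) :
    ∫ a, ℓ a ∂(X.localStats W) = ∫ x, ℓ (X.sample ((↑) : W → ℤ) x) ∂X.μ := by
  rw [X.localStats_eq, integral_map (X.measurable_sample _).aemeasurable
    (Measurable.of_discrete (f := ℓ)).aestronglyMeasurable]

theorem measurable_configuration {m : ℕ} [NeZero m] (W : Finset ℤ) :
    Measurable (fun q : ((ℤ → Sym m) × (Fin m → A)) × Fin m => fun w : W => q.1.2 (q.1.1 w q.2)) :=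
  measurable_pi_lambda _ fun w => by
    have h : Measurable (fun q : ((ℤ → Sym m) × (Fin m → A)) × Fin m =>
        ((q.1.1 w, q.1.2), q.2)) :=
      (((measurable_pi_apply (w : ℤ)).comp (measurable_fst.comp measurable_fst)).prodMk
        (measurable_snd.comp measurable_fst)).prodMk measurable_snd
    exact (measurable_of_finite
      (fun z : (Sym m × (Fin m → A)) × Fin m => z.1.2 (z.1.1 z.2))).comp h

theorem localStats_constructed {m : ℕ} [NeZero m] (η : Measure ((ℤ → Sym m) × (Fin m → A)))
    [IsProbabilityMeasure η] (W : Finset ℤ) : (constructed η).localStats W =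
      (η.prod (unif m)).map (fun q => fun w : W => q.1.2 (q.1.1 w q.2)) := rfl

theorem integral_localStats_constructed {m : ℕ} [NeZero m]
    (η : Measure ((ℤ → Sym m) × (Fin m → A))) [IsProbabilityMeasure η] (W : Finset ℤ)
    (ℓ : (W → A) → ℝ) : ∫ a, ℓ a ∂((constructed η).localStats W) =
      ∫ x, (∑ p, ℓ (fun w => x.2 (x.1 w p))) / m ∂η := by
  rw [localStats_constructed, integral_map (measurable_configuration W).aemeasurable
    (Measurable.of_discrete (f := ℓ)).aestronglyMeasurable,
    integral_prod _ (integrable_comp_of_finite (measurable_configuration W) ℓ)]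
  simp only [integral_unif]

variable [Nonempty A]

/-- A code bounds the number of models of the process. -/
theorem log_numModels_le {m : ℕ} [NeZero m] (X : ApproxProcess.{u} ℤ A) (W : Finset ℤ) (ε : ℝ)
    (hε : 0 ≤ ε) (σ : ℤ → Sym m) (ℓ : (W → A) → ℝ) (hℓ : ∀ a, 0 ≤ ℓ a) {B : ℝ}
    (hB : ∀ a, |ℓ a| ≤ B)
    (hcode : ∑ ψ : Fin m → A, Real.exp (-(∑ p, ℓ (fun w => ψ (σ w p)) +
        {p | ¬ Tracks W σ p}.ncard * Real.log (Fintype.card A))) ≤ 1) :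
    Real.log (numModels X W ε σ) / m ≤ ∫ x, ℓ (X.sample ((↑) : W → ℤ) x) ∂X.μ + 2 * B * ε +
      offTrack W σ * Real.log (Fintype.card A) := by
  classical
  rw [offTrack]
  have hm : (0 : ℝ) < m := by exact_mod_cast Nat.pos_of_ne_zero (NeZero.ne m)
  have hB0 : 0 ≤ B := by
    inhabit A
    exact (abs_nonneg _).trans (hB fun _ => default)
  set c := ∫ x, ℓ (X.sample ((↑) : W → ℤ) x) ∂X.μ with hc
  have hc0 : 0 ≤ c := integral_nonneg fun x => hℓ _
  set b : ℝ := ({p | ¬ Tracks W σ p}.ncard : ℝ) with hb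
  set l := Real.log (Fintype.card A) with hl
  have hl0 : 0 ≤ l := Real.log_natCast_nonneg _
  have hRHS : 0 ≤ c + 2 * B * ε + b / m * l := by positivity
  rcases Nat.eq_zero_or_pos (numModels X W ε σ) with h | h
  · rw [h]; simpa using hRHS
  set M := {ψ : Fin m → A | modelDist W σ ψ X < ε} with hM
  have hlen : ∀ ψ ∈ M.toFinset, Real.exp (-(m * (c + 2 * B * ε) + b * l)) ≤
      Real.exp (-(∑ p, ℓ (fun w => ψ (σ w p)) + b * l)) := by
    intro ψ hψ
    have hψ' : modelDist W σ ψ X < ε := by simpa [hM] using hψ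
    have hmeas : Measurable (fun p (w : W) => ψ (σ w p)) := measurable_of_finite _
    have : IsProbabilityMeasure ((unif m).map (fun p (w : W) => ψ (σ w p))) :=
      Measure.isProbabilityMeasure_map hmeas.aemeasurable
    have h1 := abs_integral_sub_le (X.localStats W)
      ((unif m).map (fun p (w : W) => ψ (σ w p))) ℓ hB
    rw [integral_localStats, integral_map hmeas.aemeasurable
      (Measurable.of_discrete (f := ℓ)).aestronglyMeasurable, integral_unif, abs_sub_comm] at h1
    have h2 := (le_abs_self _).trans h1
    have h3 : 2 * B * tvDist (X.localStats W) ((unif m).map (fun p (w : W) => ψ (σ w p))) ≤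
      2 * B * ε := mul_le_mul_of_nonneg_left hψ'.le (by positivity)
    have h4 : (∑ p, ℓ (fun w => ψ (σ w p))) / m ≤ c + 2 * B * ε := by linarith
    rw [div_le_iff₀ hm] at h4
    refine Real.exp_le_exp.2 (neg_le_neg ?_)
    linarith
  have hcount : (numModels X W ε σ : ℝ) * Real.exp (-(m * (c + 2 * B * ε) + b * l)) ≤ 1 := by
    refine le_trans ?_ hcode
    refine le_trans ?_ (Finset.sum_le_sum_of_subset_of_nonneg (Finset.subset_univ M.toFinset)
      fun _ _ _ => (Real.exp_pos _).le)
    refine le_trans (le_of_eq ?_) (Finset.sum_le_sum hlen)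
    rw [Finset.sum_const, nsmul_eq_mul, numModels, Set.ncard_eq_toFinset_card']
  rw [Real.exp_neg, ← div_eq_mul_inv, div_le_one (Real.exp_pos _)] at hcount
  have := Real.log_le_log (by exact_mod_cast h) hcount
  rw [Real.log_exp] at this
  rw [div_le_iff₀ hm]
  refine this.trans (le_of_eq ?_)
  field_simp

theorem soficEntropy_le (K : RandomSoficApprox ℤ) (X : ApproxProcess.{u} ℤ A) :
    soficEntropy K X ≤ (X.rate : EReal) := by
  refine EReal.le_of_forall_lt_iff_le.1 fun c hc => ?_
  obtain ⟨W, ℓ, hℓ, hlt, hcode⟩ := exists_code X (EReal.coe_lt_coe_iff.1 hc)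
  obtain ⟨B, hB0, hB⟩ := exists_abs_le ℓ
  set c₀ := ∫ x, ℓ (X.sample ((↑) : W → ℤ) x) ∂X.μ with hc₀
  set ε := (c - c₀) / (2 * (2 * B + 1)) with hε
  have hd : 0 < 2 * B + 1 := by positivity
  have hε0 : 0 < ε := div_pos (by linarith) (by positivity)
  have hεB : c₀ + 2 * B * ε < c := by
    have : 2 * B * ε ≤ (2 * B + 1) * ε := by nlinarith
    have h2 : (2 * B + 1) * ε = (c - c₀) / 2 := by rw [hε]; field_simp
    linarith
  refine (iInf_le_of_le W (iInf₂_le_of_le ε hε0 le_rfl)).trans ?_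
  refine limsup_le_of_le (by isBoundedDefault) ?_
  have hbad := ((tendsto_integral_offTrack K W).mul_const
    (Real.log (Fintype.card A))).const_add (c₀ + 2 * B * ε)
  rw [zero_mul, add_zero] at hbad
  filter_upwards [hbad.eventually (gt_mem_nhds hεB)] with i hi
  unfold avgLogNumModels
  split_ifs
  · exact bot_le
  rw [EReal.coe_le_coe_iff, ← integral_div]
  refine le_trans ?_ hi.le
  have hint := (integrable_offTrack (K.κ i) W).mul_const (Real.log (Fintype.card A))
  calc _ ≤ ∫ σ, (c₀ + 2 * B * ε + offTrack W σ * Real.log (Fintype.card A)) ∂(K.κ i) := by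
        refine integral_mono ((integrable_log_numModels X W ε _).div_const _)
          ((integrable_const _).add hint) fun σ => ?_
        exact log_numModels_le X W ε hε0.le σ ℓ hℓ hB (hcode (K.m i) σ)
    _ = _ := by
        rw [integral_add (integrable_const _) hint, integral_mul_const]; simp

/-- A code that works over every `σ` bounds the conditional entropy given `σ`. -/
theorem condEntropy_le {m : ℕ} [NeZero m] (η : Measure ((ℤ → Sym m) × (Fin m → A)))
    [IsProbabilityMeasure η] (W : Finset ℤ) (ℓ : (W → A) → ℝ)
    (hcode : ∀ σ : ℤ → Sym m, ∑ ψ : Fin m → A, Real.exp (-(∑ p, ℓ (fun w => ψ (σ w p)) +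
        {p | ¬ Tracks W σ p}.ncard * Real.log (Fintype.card A))) ≤ 1) :
    condEntropy η ≤ ∫ a, ℓ a ∂((constructed η).localStats W) +
      (∫ σ, offTrack W σ ∂η.fst) * Real.log (Fintype.card A) := by
  have hm : (0 : ℝ) < m := by exact_mod_cast Nat.pos_of_ne_zero (NeZero.ne m)
  set l := Real.log (Fintype.card A) with hl
  have h1 : Integrable (fun x : (ℤ → Sym m) × (Fin m → A) =>
      (∑ p, ℓ (fun w => x.2 (x.1 w p))) / m) η := by
    have := (integrable_comp_of_finite (μ := η.prod (unif m)) (measurable_configuration W)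
      ℓ).integral_prod_left
    simpa only [integral_unif] using this
  have h2 : Integrable (fun x : (ℤ → Sym m) × (Fin m → A) => offTrack W x.1 * l) η :=
    (((integrable_offTrack η.fst W).comp_measurable measurable_fst).mul_const l)
  have h3 : ∫ x, offTrack W x.1 ∂η = ∫ σ, offTrack W σ ∂η.fst := by
    rw [Measure.fst, integral_map measurable_fst.aemeasurable
      (integrable_offTrack η.fst W).aestronglyMeasurable]
  have h4 := Measure.integral_condKernel (h1.add h2)
  have h5 : ∫ x, ((∑ p, ℓ (fun w => x.2 (x.1 w p))) / m + offTrack W x.1 * l) ∂η =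
      ∫ a, ℓ a ∂((constructed η).localStats W) + (∫ σ, offTrack W σ ∂η.fst) * l := by
    rw [integral_add h1 h2, integral_localStats_constructed, integral_mul_const, h3]
  rw [← h5]
  refine le_trans ?_ h4.le
  rw [condEntropy, ← integral_div]
  refine integral_mono_of_nonneg (ae_of_all _ fun σ => ?_) (h1.add h2).integral_condKernel
    (ae_of_all _ fun σ => ?_)
  · exact div_nonneg (shannonEntropy_nonneg _) hm.le
  · have := shannonEntropy_le_integral (η.condKernel σ) _ (hcode σ)
    simp only [Pi.add_apply]
    rw [div_le_iff₀ hm, ← integral_mul_const]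
    refine this.trans (le_of_eq ?_)
    refine integral_congr_ae (ae_of_all _ fun ψ => ?_)
    simp only [offTrack]
    field_simp

theorem upperSoficEntropy_le (K : RandomSoficApprox ℤ) (X : ApproxProcess.{u} ℤ A) :
    upperSoficEntropy K X ≤ (X.rate : EReal) := by
  refine sSup_le ?_
  rintro _ ⟨n, hn, η, hη, hfst, hconv, rfl⟩
  refine EReal.le_of_forall_lt_iff_le.1 fun c hc => ?_
  obtain ⟨W, ℓ, hℓ, hlt, hcode⟩ := exists_code X (EReal.coe_lt_coe_iff.1 hc)
  obtain ⟨B, hB0, hB⟩ := exists_abs_le ℓ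
  refine limsup_le_of_le (by isBoundedDefault) ?_
  have hbad := ((tendsto_integral_offTrack K W).comp hn.tendsto_atTop).mul_const
    (Real.log (Fintype.card A))
  have hd := ((hconv W).const_mul (2 * B)).add hbad
  have hd' := hd.const_add (∫ x, ℓ (X.sample ((↑) : W → ℤ) x) ∂X.μ)
  rw [mul_zero, zero_mul, add_zero, add_zero] at hd'
  filter_upwards [hd'.eventually (gt_mem_nhds hlt)] with j hj
  rw [EReal.coe_le_coe_iff]
  have h1 := condEntropy_le (η j) W ℓ (hcode _)
  have h2 := (le_abs_self _).trans (abs_integral_sub_le ((constructed (η j)).localStats W)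
    (X.localStats W) ℓ hB)
  rw [integral_localStats X] at h2
  rw [hfst j] at h1
  simp only [Function.comp_apply, ApproxProcess.dist] at hj
  linarith

end UpperBounds

/-! ### Random configurations from independent orbit segments -/

section Draw

variable {A : Type w} [MeasurableSpace A]

/-- The label of the block of length `n` that contains the rank of `p`. There are at most `m`
blocks, so the labels are taken in `Fin m`; for `n = 0` and for `n = m` there is a single block. -/
def blockOf {m : ℕ} (n : ℕ) (τ : Sym m) (p : Fin m) : Fin m :=
  ⟨rank τ p / n, (Nat.div_le_self _ _).trans_lt (rank_lt τ p)⟩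

/-- The configuration that reads the process along the ranks of the points, with a starting point
`x b` of its own for each block `b`. -/
def draw (X : ApproxProcess.{u} ℤ A) {m : ℕ} (n : ℕ) (τ : Sym m) (x : Fin m → X.Ω) : Fin m → A :=
  fun p => X.φ (X.T (rank τ p) (x (blockOf n τ p)))

/-- Independent starting points, one for each block. -/
abbrev starts (X : ApproxProcess.{u} ℤ A) (m : ℕ) : Measure (Fin m → X.Ω) :=
  Measure.pi fun _ => X.μ

/-- The law of `draw` for independent starting points. -/
def drawLaw (X : ApproxProcess.{u} ℤ A) {m : ℕ} (n : ℕ) (τ : Sym m) : Measure (Fin m → A) :=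
  (starts X m).map (draw X n τ)

/-- The point `p` is moved by `σ` as a translation of the ranks, inside its own block. -/
def Coherent {m : ℕ} (n : ℕ) (W : Finset ℤ) (σ : ℤ → Sym m) (p : Fin m) : Prop :=
  Tracks W σ p ∧ ∀ w ∈ W, rank (σ 1) (σ w p) / n = rank (σ 1) p / n

/-- The proportion of points that are not coherent. -/
def incoherence {m : ℕ} (n : ℕ) (W : Finset ℤ) (σ : ℤ → Sym m) : ℝ :=
  ({p | ¬ Coherent n W σ p}.ncard : ℝ) / m

variable {X : ApproxProcess.{u} ℤ A} {m n : ℕ}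

theorem measurable_draw (τ : Sym m) : Measurable (draw X n τ) :=
  measurable_pi_lambda _ fun _ =>
    (X.measurable_φ.comp (X.measurePreserving _).measurable).comp (measurable_pi_apply _)

instance (τ : Sym m) : IsProbabilityMeasure (drawLaw X n τ) :=
  Measure.isProbabilityMeasure_map (measurable_draw τ).aemeasurable

theorem draw_comp_eq_sample {W : Finset ℤ} {σ : ℤ → Sym m} {p : Fin m} (h : Coherent n W σ p)
    (x : Fin m → X.Ω) : (fun w : W => draw X n (σ 1) x (σ w p)) =
      X.sample (fun w : W => (w : ℤ) + rank (σ 1) p) (x (blockOf n (σ 1) p)) := by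
  funext w
  have h1 := h.1 w w.2
  have h2 : blockOf n (σ 1) (σ w p) = blockOf n (σ 1) p := Fin.ext (h.2 w w.2)
  simp only [draw, ApproxProcess.sample, h1, h2, add_comm (w : ℤ)]

theorem card_fiber_blockOf_le (hn : 0 < n) (τ : Sym m) (b : Fin m) :
    (Finset.univ.filter fun p => blockOf n τ p = b).card ≤ n := by
  have := Finset.card_le_card_of_injOn (s := Finset.univ.filter fun p => blockOf n τ p = b)
    (t := Finset.range n) (fun p => rank τ p % n)
    (fun p _ => Finset.mem_coe.2 (Finset.mem_range.2 (Nat.mod_lt _ hn))) (by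
      intro p hp q hq h
      have hp' : rank τ p / n = b := congrArg Fin.val (Finset.mem_filter.1 hp).2
      have hq' : rank τ q / n = b := congrArg Fin.val (Finset.mem_filter.1 hq).2
      refine rank_injective τ ?_
      simp only at h
      rw [← Nat.div_add_mod (rank τ p) n, ← Nat.div_add_mod (rank τ q) n, hp', hq', h])
  simpa using this

/-- Apart from the points where `σ` is not a translation, only points close to the ends of the
blocks are incoherent. -/
theorem incoherence_le [NeZero m] (hn : 0 < n) {W : Finset ℤ} {R : ℕ} (hR : ∀ w ∈ W, |w| ≤ R)
    (σ : ℤ → Sym m) : incoherence n W σ ≤ offTrack W σ + 2 * R * (1 / n + 1 / m) := by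
  have hm : (0 : ℝ) < m := by exact_mod_cast Nat.pos_of_ne_zero (NeZero.ne m)
  have hn' : (0 : ℝ) < n := by exact_mod_cast hn
  set r := rank (σ 1) with hr
  set S : Set (Fin m) := {p | r p % n < R ∨ n - R ≤ r p % n} with hS
  have h1 : {p | ¬ Coherent n W σ p} ⊆ {p | ¬ Tracks W σ p} ∪ S := by
    intro p hp
    by_contra hcon
    simp only [hS, Set.mem_union, Set.mem_ofPred_eq, not_or, not_not, not_lt, not_le] at hcon hp
    obtain ⟨ht, hlo, hhi⟩ := hcon
    refine hp ⟨ht, fun w hw => ?_⟩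
    have e := ht w hw
    have hRw := abs_le.1 (hR w hw)
    change r (σ w p) / n = r p / n
    have e' : (r (σ w p) : ℤ) = r p + w := e
    have hdm := Nat.div_add_mod (r p) n
    refine Nat.div_eq_of_lt_le ?_ ?_
    · have : r p / n * n = n * (r p / n) := mul_comm _ _
      omega
    · have : (r p / n + 1) * n = n * (r p / n) + n := by ring
      omega
  have h2 : S.ncard ≤ (m / n + 1) * (2 * R) := by
    have hT : (Finset.range R ∪ Finset.Ico (n - R) n).card ≤ 2 * R := by
      refine (Finset.card_union_le _ _).trans ?_
      rw [Finset.card_range, Nat.card_Ico]; omega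
    have := Set.ncard_le_ncard_of_injOn (s := S)
      (t := ((Finset.range (m / n + 1) ×ˢ (Finset.range R ∪ Finset.Ico (n - R) n) :
        Finset (ℕ × ℕ)) : Set (ℕ × ℕ))) (fun p => (r p / n, r p % n))
      (by
        intro p hp
        have hlt : r p < m := rank_lt (σ 1) p
        have h3 : r p / n < m / n + 1 := Nat.lt_succ_of_le (Nat.div_le_div_right hlt.le)
        have h4 := Nat.mod_lt (r p) hn
        simp only [hS, Set.mem_ofPred_eq] at hp
        simp only [Finset.coe_product, Set.mem_prod, Finset.mem_coe, Finset.mem_range,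
          Finset.mem_union, Finset.mem_Ico]
        exact ⟨h3, hp.imp id fun h => ⟨h, h4⟩⟩)
      (by
        intro p _ q _ h
        have ha := congrArg Prod.fst h
        have hb := congrArg Prod.snd h
        refine rank_injective (σ 1) ?_
        simp only at ha hb
        change r p = r q
        rw [← Nat.div_add_mod (r p) n, ← Nat.div_add_mod (r q) n, ha, hb])
      (Finset.finite_toSet _)
    rw [Set.ncard_coe_finset, Finset.card_product, Finset.card_range] at this
    exact this.trans (Nat.mul_le_mul_left _ hT)
  have h3 := (Set.ncard_le_ncard h1 (Set.toFinite _)).trans (Set.ncard_union_le _ _)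
  have h4 : ({p | ¬ Coherent n W σ p}.ncard : ℝ) ≤ {p | ¬ Tracks W σ p}.ncard +
      ((m / n : ℕ) + 1) * (2 * R) := by
    exact_mod_cast h3.trans (Nat.add_le_add_left h2 _)
  have h5 : ((m / n : ℕ) : ℝ) ≤ m / n := Nat.cast_div_le
  rw [incoherence, offTrack, div_le_iff₀ hm, add_mul, div_mul_cancel₀ _ hm.ne']
  have h6 : 2 * (R : ℝ) * (1 / n + 1 / m) * m = (m / n + 1) * (2 * R) := by field_simp
  rw [h6]
  have h7 : (((m / n : ℕ) : ℝ) + 1) * (2 * R) ≤ (m / n + 1) * (2 * R) := by gcongr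
  linarith

/-- With a single block every point that `σ` moves as a translation is coherent. -/
theorem incoherence_self (W : Finset ℤ) (σ : ℤ → Sym m) :
    incoherence m W σ = offTrack W σ := by
  unfold incoherence offTrack
  have : {p | ¬ Coherent m W σ p} = {p | ¬ Tracks W σ p} := by
    ext
    refine not_congr ⟨fun h => h.1, fun h => ⟨h, fun w _ => ?_⟩⟩
    rw [Nat.div_eq_of_lt (rank_lt _ _), Nat.div_eq_of_lt (rank_lt _ _)]
  rw [this]

theorem map_sample_eq_localStats (hX : X.IsAction) (W : Finset ℤ) (g : ℤ) :
    X.μ.map (X.sample (fun w : W => (w : ℤ) + g)) = X.localStats W :=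
  ApproxProcess.map_sample_add hX _ g

variable [Finite A] [DiscreteMeasurableSpace A]

/-- Each site contributes at least the entropy rate to the entropy of the random configuration. -/
theorem mul_rate_le_shannonEntropy_drawLaw (hX : X.IsAction) (τ : Sym m) :
    m * X.rate ≤ shannonEntropy (drawLaw X n τ) := by
  classical
  rw [drawLaw, shannonEntropy_map (measurable_draw τ)]
  set s : ∀ b : Fin m, X.Ω → ({p // blockOf n τ p = b} → A) :=
    fun b => X.sample (fun p => (rank τ p : ℤ)) with hs
  have hsm : ∀ b, Measurable (s b) := fun b => X.measurable_sample _
  have hset : ∀ x : Fin m → X.Ω, {y | draw X n τ y = draw X n τ x} =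
      Set.univ.pi (fun b => {z | s b z = s b (x b)}) := by
    intro x
    ext y
    simp only [Set.mem_ofPred_eq, Set.mem_pi, Set.mem_univ, true_implies, funext_iff, hs,
      Subtype.forall, draw, ApproxProcess.sample]
    constructor
    · rintro h b p rfl
      exact h p
    · intro h p
      exact h _ p rfl
  have hreal : ∀ x : Fin m → X.Ω, (starts X m).real {y | draw X n τ y = draw X n τ x} =
      ∏ b, X.μ.real {z | s b z = s b (x b)} := by
    intro x
    rw [hset, measureReal_def, Measure.pi_pi, ENNReal.toReal_prod]
    rfl
  have hpos : ∀ᵐ x ∂(starts X m), ∀ b, 0 < X.μ.real {z | s b z = s b (x b)} :=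
    ae_all_iff.2 fun b =>
      (measurePreserving_eval (fun _ : Fin m => X.μ) b).quasiMeasurePreserving.ae
        (ae_fiber_pos (s b))
  have hint : ∀ b, Integrable (fun x : Fin m → X.Ω => -Real.log (X.μ.real {z | s b z = s b (x b)}))
      (starts X m) := fun b =>
    integrable_comp_eval (μ := fun _ : Fin m => X.μ) (i := b) (integrable_log_fiber (hsm b))
  have hsum : fiberEntropy (starts X m) (draw X n τ) = ∑ b, fiberEntropy X.μ (s b) := by
    unfold fiberEntropy
    have : ∀ b, ∫ x, -Real.log (X.μ.real {z | s b z = s b x}) ∂X.μ =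
        ∫ x : Fin m → X.Ω, -Real.log (X.μ.real {z | s b z = s b (x b)}) ∂(starts X m) :=
      fun b => (integral_comp_eval (μ := fun _ : Fin m => X.μ) (i := b)
        (integrable_log_fiber (hsm b)).aestronglyMeasurable).symm
    rw [Finset.sum_congr rfl fun b _ => this b, ← integral_finsetSum _ fun b _ => hint b]
    refine integral_congr_ae ?_
    filter_upwards [hpos] with x hx
    rw [hreal, Real.log_prod fun b _ => (hx b).ne', Finset.sum_neg_distrib]
  have hblock : ∀ b, ((Finset.univ.filter fun p => blockOf n τ p = b).card : ℝ) * X.rate ≤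
      fiberEntropy X.μ (s b) := by
    intro b
    rw [hs, X.fiberEntropy_sample]
    refine le_trans (le_of_eq ?_) (ApproxProcess.card_mul_rate_le hX _)
    rw [Finset.card_image_of_injective, Finset.card_univ, Fintype.card_subtype]
    intro p q h
    exact Subtype.ext (rank_injective τ (Int.ofNat_inj.1 h))
  rw [hsum]
  refine le_trans (le_of_eq ?_) (Finset.sum_le_sum fun b _ => hblock b)
  rw [← Finset.sum_mul, ← Nat.cast_sum,
    ← Finset.card_eq_sum_card_fiberwise (fun p _ => Finset.mem_coe.2 (Finset.mem_univ _))]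
  simp

/-- At a coherent point the random configuration has the local statistics of the process. -/
theorem integral_draw_of_coherent (hX : X.IsAction) {W : Finset ℤ} {σ : ℤ → Sym m} {p : Fin m}
    (h : Coherent n W σ p) (ℓ : (W → A) → ℝ) :
    ∫ x, ℓ (fun w => draw X n (σ 1) x (σ w p)) ∂(starts X m) =
      ∫ a, ℓ a ∂(X.localStats W) := by
  simp only [draw_comp_eq_sample h]
  have hsm := X.measurable_sample (fun w : W => (w : ℤ) + rank (σ 1) p)
  rw [← map_sample_eq_localStats hX W (rank (σ 1) p), integral_map hsm.aemeasurable
    (Measurable.of_discrete (f := ℓ)).aestronglyMeasurable]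
  exact integral_comp_eval (μ := fun _ : Fin m => X.μ) (i := blockOf n (σ 1) p)
    ((Measurable.of_discrete (f := ℓ)).comp hsm).aestronglyMeasurable

/-- Coherent points of different blocks are uncorrelated. -/
theorem integral_mul_draw_of_coherent (hX : X.IsAction) {W : Finset ℤ} {σ : ℤ → Sym m}
    {p q : Fin m} (hp : Coherent n W σ p) (hq : Coherent n W σ q)
    (hpq : blockOf n (σ 1) p ≠ blockOf n (σ 1) q) (ℓ : (W → A) → ℝ)
    (hℓ : ∫ a, ℓ a ∂(X.localStats W) = 0) :
    ∫ x, ℓ (fun w => draw X n (σ 1) x (σ w p)) * ℓ (fun w => draw X n (σ 1) x (σ w q))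
      ∂(starts X m) = 0 := by
  have h1 := integral_draw_of_coherent hX hp ℓ
  rw [hℓ] at h1
  simp only [draw_comp_eq_sample hp, draw_comp_eq_sample hq] at h1 ⊢
  set f := fun z => ℓ (X.sample (fun w : W => (w : ℤ) + rank (σ 1) p) z) with hf
  set g := fun z => ℓ (X.sample (fun w : W => (w : ℤ) + rank (σ 1) q) z) with hg
  have hfm : Measurable f := (Measurable.of_discrete (f := ℓ)).comp (X.measurable_sample _)
  have hgm : Measurable g := (Measurable.of_discrete (f := ℓ)).comp (X.measurable_sample _)
  have hind := (iIndepFun_pi (μ := fun _ : Fin m => X.μ) (X := fun _ z => z)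
    (fun _ => aemeasurable_id)).indepFun hpq
  have hind2 := hind.comp hfm hgm
  have := hind2.integral_fun_mul_eq_mul_integral
    (hfm.comp (measurable_pi_apply (blockOf n (σ 1) p))).aestronglyMeasurable
    (hgm.comp (measurable_pi_apply (blockOf n (σ 1) q))).aestronglyMeasurable
  refine this.trans ?_
  rw [show ∫ x, (f ∘ fun ω : Fin m → X.Ω => ω (blockOf n (σ 1) p)) x ∂(starts X m) = 0 from h1,
    zero_mul]

end Draw

/-! ### Lower bound for the upper-sofic entropy -/

section LowerUpperSofic

variable {A : Type w} [MeasurableSpace A] {X : ApproxProcess.{u} ℤ A} {m n : ℕ}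

/-- The random configuration as a kernel over `σ`. -/
def drawKernel (X : ApproxProcess.{u} ℤ A) (m n : ℕ) : Kernel (ℤ → Sym m) (Fin m → A) :=
  (Kernel.ofFunOfCountable (fun τ : Sym m => drawLaw X n τ)).comap (fun σ => σ 1)
    (measurable_pi_apply 1)

theorem drawKernel_apply (σ : ℤ → Sym m) : drawKernel X m n σ = drawLaw X n (σ 1) := rfl

variable [Finite A] [DiscreteMeasurableSpace A]

theorem integral_drawLaw (τ : Sym m) (f : (Fin m → A) → ℝ) :
    ∫ ψ, f ψ ∂(drawLaw X n τ) = ∫ x, f (draw X n τ x) ∂(starts X m) :=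
  integral_map (measurable_draw τ).aemeasurable
    (Measurable.of_discrete (f := f)).aestronglyMeasurable

theorem integrable_draw (τ : Sym m) (f : (Fin m → A) → ℝ) :
    Integrable (fun x => f (draw X n τ x)) (starts X m) :=
  integrable_comp_of_finite (measurable_draw τ) f

theorem integral_mem_Icc {S : Type*} [Finite S] [MeasurableSpace S] [MeasurableSingletonClass S]
    (ν : Measure S) [IsProbabilityMeasure ν] {ℓ : S → ℝ} (hℓ : ∀ a, ℓ a ∈ Set.Icc (0 : ℝ) 1) :
    ∫ a, ℓ a ∂ν ∈ Set.Icc (0 : ℝ) 1 := by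
  refine ⟨integral_nonneg fun a => (hℓ a).1, ?_⟩
  have := integral_mono (μ := ν) (Integrable.of_finite (f := ℓ)) (integrable_const (1 : ℝ))
    fun a => (hℓ a).2
  simpa using this

/-- The mean local statistics of the random configuration, over a fixed `σ`. -/
theorem abs_integral_drawLaw_sub_le [NeZero m] (hX : X.IsAction) (W : Finset ℤ) (σ : ℤ → Sym m)
    {ℓ : (W → A) → ℝ} (hℓ : ∀ a, ℓ a ∈ Set.Icc (0 : ℝ) 1) :
    |∫ ψ, (∑ p, ℓ (fun w => ψ (σ w p))) / m ∂(drawLaw X n (σ 1)) -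
      ∫ a, ℓ a ∂(X.localStats W)| ≤ incoherence n W σ := by
  classical
  have hm : (0 : ℝ) < m := by exact_mod_cast Nat.pos_of_ne_zero (NeZero.ne m)
  set c := ∫ a, ℓ a ∂(X.localStats W) with hc
  have hc01 : c ∈ Set.Icc (0 : ℝ) 1 := integral_mem_Icc _ hℓ
  rw [integral_drawLaw, integral_div, integral_finsetSum _ fun p _ =>
    integrable_draw (σ 1) fun ψ => ℓ (fun w => ψ (σ w p))]
  have e : (∑ p, ∫ x, ℓ (fun w => draw X n (σ 1) x (σ w p)) ∂(starts X m)) / m - c =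
      (∑ p, (∫ x, ℓ (fun w => draw X n (σ 1) x (σ w p)) ∂(starts X m) - c)) / m := by
    rw [Finset.sum_sub_distrib]; simp; field_simp
  rw [e, abs_div, abs_of_pos hm, incoherence]
  refine div_le_div_of_nonneg_right ?_ hm.le
  refine (Finset.abs_sum_le_sum_abs _ _).trans ?_
  have hb := ncard_eq_sum_ite fun p => ¬ Coherent n W σ p
  rw [hb]
  refine Finset.sum_le_sum fun p _ => ?_
  by_cases hp : Coherent n W σ p
  · rw [integral_draw_of_coherent hX hp ℓ]; simp [hp, hc]
  · have h01 : ∫ x, ℓ (fun w => draw X n (σ 1) x (σ w p)) ∂(starts X m) ∈ Set.Icc (0 : ℝ) 1 := by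
      have := integral_mem_Icc (drawLaw X n (σ 1)) (ℓ := fun ψ => ℓ (fun w => ψ (σ w p)))
        fun _ => hℓ _
      rwa [integral_drawLaw] at this
    rw [if_pos hp, abs_le]
    constructor <;> linarith [h01.1, h01.2, hc01.1, hc01.2]

instance : IsMarkovKernel (drawKernel X m n) :=
  ⟨fun σ => by rw [drawKernel_apply]; infer_instance⟩

theorem dist_constructed_le [NeZero m] (hX : X.IsAction) (κ : Measure (ℤ → Sym m))
    [IsProbabilityMeasure κ] (W : Finset ℤ) :
    ApproxProcess.dist W (constructed (κ ⊗ₘ drawKernel X m m)) X ≤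
      Nat.card (W → A) * ∫ σ, offTrack W σ ∂κ := by
  classical
  cases nonempty_fintype A
  have hnn : 0 ≤ ∫ σ, offTrack W σ ∂κ := integral_nonneg fun σ => offTrack_nonneg W σ
  have key : ∀ a : W → A, |((constructed (κ ⊗ₘ drawKernel X m m)).localStats W).real {a} -
      (X.localStats W).real {a}| ≤ ∫ σ, offTrack W σ ∂κ := by
    intro a
    set ℓ : (W → A) → ℝ := ({a} : Set (W → A)).indicator 1 with hℓ
    have hℓ01 : ∀ b, ℓ b ∈ Set.Icc (0 : ℝ) 1 := by
      intro b
      simp only [hℓ, Set.indicator_apply]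
      split_ifs <;> simp
    have e : ∀ ν : Measure (W → A), ν.real {a} = ∫ b, ℓ b ∂ν := fun ν =>
      (integral_indicator_one (MeasurableSet.singleton a)).symm
    have hint : Integrable (fun x : (ℤ → Sym m) × (Fin m → A) =>
        (∑ p, ℓ (fun w => x.2 (x.1 w p))) / m) (κ ⊗ₘ drawKernel X m m) := by
      have := (integrable_comp_of_finite (μ := (κ ⊗ₘ drawKernel X m m).prod (unif m))
        (measurable_configuration W) ℓ).integral_prod_left
      simpa only [integral_unif] using this
    rw [e, e, integral_localStats_constructed, Measure.integral_compProd hint]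
    simp only [drawKernel_apply]
    have hin : Integrable (fun σ => ∫ ψ, (∑ p, ℓ (fun w => ψ (σ w p))) / m ∂(drawLaw X m (σ 1)))
        κ := hint.integral_compProd
    have h1 : ∫ b, ℓ b ∂(X.localStats W) = ∫ _, (∫ b, ℓ b ∂(X.localStats W)) ∂κ := by simp
    rw [h1, ← integral_sub hin (integrable_const _)]
    refine (abs_integral_le_integral_abs).trans ?_
    refine integral_mono (hin.sub (integrable_const _)).abs (integrable_offTrack κ W) fun σ => ?_
    rw [← incoherence_self]
    exact abs_integral_drawLaw_sub_le hX W σ hℓ01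
  rw [ApproxProcess.dist, tvDist_eq_sum]
  have h2 := Finset.sum_le_sum fun a (_ : a ∈ Finset.univ) => key a
  rw [Finset.sum_const, nsmul_eq_mul, Finset.card_univ] at h2
  rw [Nat.card_eq_fintype_card]
  have h3 : 0 ≤ (Fintype.card (W → A) : ℝ) * ∫ σ, offTrack W σ ∂κ := by positivity
  linarith

variable [Nonempty A]

theorem rate_le_condEntropy_compProd [NeZero m] (hX : X.IsAction) (κ : Measure (ℤ → Sym m))
    [IsProbabilityMeasure κ] : X.rate ≤ condEntropy (κ ⊗ₘ drawKernel X m n) := by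
  have hm : (0 : ℝ) < m := by exact_mod_cast Nat.pos_of_ne_zero (NeZero.ne m)
  set η := κ ⊗ₘ drawKernel X m n with hη
  have hfst : η.fst = κ := Measure.fst_compProd _ _
  have hae := eq_condKernel_of_measure_eq_compProd (ρ := η) (drawKernel X m n) (by rw [hfst])
  rw [condEntropy, le_div_iff₀ hm]
  have : ∫ σ, shannonEntropy (η.condKernel σ) ∂η.fst =
      ∫ σ, shannonEntropy (drawLaw X n (σ 1)) ∂η.fst := by
    refine integral_congr_ae ?_
    filter_upwards [hae] with σ hσ
    rw [← hσ, drawKernel_apply]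
  rw [this, hfst]
  have hint : Integrable (fun σ : ℤ → Sym m => shannonEntropy (drawLaw X n (σ 1))) κ :=
    integrable_comp_of_finite (f := fun σ : ℤ → Sym m => σ 1) (measurable_pi_apply 1)
      (fun τ => shannonEntropy (drawLaw X n τ))
  have h := integral_mono (integrable_const (m * X.rate)) hint
    fun σ => mul_rate_le_shannonEntropy_drawLaw hX (σ 1)
  simp only [integral_const, probReal_univ, one_smul] at h
  linarith

theorem le_upperSoficEntropy (hX : X.IsAction) (K : RandomSoficApprox ℤ) :
    (X.rate : EReal) ≤ upperSoficEntropy K X := by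
  refine le_trans ?_ (le_sSup ⟨id, strictMono_id,
    fun j => K.κ j ⊗ₘ drawKernel X (K.m j) (K.m j), fun j => inferInstance,
    fun j => Measure.fst_compProd _ _, fun W => ?_, rfl⟩)
  · refine le_limsup_of_frequently_le' (Eventually.frequently (Eventually.of_forall fun j => ?_))
    exact EReal.coe_le_coe_iff.2 (rate_le_condEntropy_compProd hX _)
  · have h := (tendsto_integral_offTrack K W).const_mul (Nat.card (W → A) : ℝ)
    rw [mul_zero] at h
    refine squeeze_zero (fun j => ?_) (fun j => dist_constructed_le hX (K.κ j) W) h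
    exact mul_nonneg (by norm_num) (tsum_nonneg fun _ => abs_nonneg _)

end LowerUpperSofic

/-! ### Lower bound for the sofic entropy -/

section LowerSofic

variable {A : Type w} [MeasurableSpace A] {X : ApproxProcess.{u} ℤ A} {m n : ℕ}

theorem compl_models {m : ℕ} (W : Finset ℤ) (σ : ℤ → Sym m) (ε : ℝ) :
    {ψ : Fin m → A | modelDist W σ ψ X < ε}ᶜ = {ψ | ε ≤ modelDist W σ ψ X} := by
  ext ψ; simp

variable [Fintype A] [DiscreteMeasurableSpace A]

/-- The variance of the empirical statistics of the random configuration: only pairs of points that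
share a block or contain an incoherent point contribute. -/
theorem integral_sq_drawLaw_sub_le [NeZero m] (hn : 0 < n) (hX : X.IsAction) (W : Finset ℤ)
    (σ : ℤ → Sym m) {ℓ : (W → A) → ℝ} (hℓ : ∀ a, ℓ a ∈ Set.Icc (0 : ℝ) 1) :
    ∫ ψ, ((∑ p, ℓ (fun w => ψ (σ w p))) / m - ∫ a, ℓ a ∂(X.localStats W)) ^ 2
      ∂(drawLaw X n (σ 1)) ≤ 2 * incoherence n W σ + n / m := by
  classical
  have hm : (0 : ℝ) < m := by exact_mod_cast Nat.pos_of_ne_zero (NeZero.ne m)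
  set c := ∫ a, ℓ a ∂(X.localStats W) with hc
  have hc01 : c ∈ Set.Icc (0 : ℝ) 1 := integral_mem_Icc _ hℓ
  -- Centre the observable, so that uncorrelated pairs contribute nothing.
  set ℓ' : (W → A) → ℝ := fun a => ℓ a - c with hℓ'
  have hℓ'0 : ∫ a, ℓ' a ∂(X.localStats W) = 0 := by
    rw [integral_sub Integrable.of_finite (integrable_const _)]; simp [hc]
  have hℓ'1 : ∀ a, |ℓ' a| ≤ 1 := fun a => by
    have := hℓ a
    simp only [hℓ', abs_le]
    constructor <;> linarith [this.1, this.2, hc01.1, hc01.2]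
  have e : ∀ ψ : Fin m → A, ((∑ p, ℓ (fun w => ψ (σ w p))) / m - c) ^ 2 =
      (∑ p, ∑ q, ℓ' (fun w => ψ (σ w p)) * ℓ' (fun w => ψ (σ w q))) / (m : ℝ) ^ 2 := by
    intro ψ
    rw [← Finset.sum_mul_sum, ← sq, ← div_pow]
    congr 1
    simp only [hℓ', Finset.sum_sub_distrib]
    simp; field_simp
  simp only [e]
  rw [integral_drawLaw, integral_div,
    integral_finsetSum _ fun p _ => integrable_draw (σ 1)
      fun ψ => ∑ q, ℓ' (fun w => ψ (σ w p)) * ℓ' (fun w => ψ (σ w q))]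
  have hpair : ∀ p q, ∫ x, ℓ' (fun w => draw X n (σ 1) x (σ w p)) *
      ℓ' (fun w => draw X n (σ 1) x (σ w q)) ∂(starts X m) ≤
      ((if ¬ Coherent n W σ p then (1 : ℝ) else 0) + (if ¬ Coherent n W σ q then (1 : ℝ) else 0)) +
        (if blockOf n (σ 1) q = blockOf n (σ 1) p then (1 : ℝ) else 0) := by
    intro p q
    have hle : ∫ x, ℓ' (fun w => draw X n (σ 1) x (σ w p)) *
        ℓ' (fun w => draw X n (σ 1) x (σ w q)) ∂(starts X m) ≤ 1 := by
      have := integral_mono (μ := starts X m) (integrable_draw (n := n) (σ 1)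
        fun ψ => ℓ' (fun w => ψ (σ w p)) * ℓ' (fun w => ψ (σ w q))) (integrable_const (1 : ℝ))
        (fun x => (le_abs_self _).trans (by
          rw [abs_mul]; exact mul_le_one₀ (hℓ'1 _) (abs_nonneg _) (hℓ'1 _)))
      simpa using this
    have i1 : (0 : ℝ) ≤ if ¬ Coherent n W σ p then (1 : ℝ) else 0 := by split_ifs <;> norm_num
    have i2 : (0 : ℝ) ≤ if ¬ Coherent n W σ q then (1 : ℝ) else 0 := by split_ifs <;> norm_num
    have i3 : (0 : ℝ) ≤ if blockOf n (σ 1) q = blockOf n (σ 1) p then (1 : ℝ) else 0 := by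
      split_ifs <;> norm_num
    by_cases hp : Coherent n W σ p
    · by_cases hq : Coherent n W σ q
      · by_cases hb : blockOf n (σ 1) q = blockOf n (σ 1) p
        · rw [if_pos hb]; linarith
        · rw [integral_mul_draw_of_coherent hX hp hq (Ne.symm hb) ℓ' hℓ'0]; linarith
      · rw [if_pos hq]; linarith
    · rw [if_pos hp]; linarith
  have hb := ncard_eq_sum_ite fun p => ¬ Coherent n W σ p
  have hsum : ∑ p, ∫ x, (∑ q, ℓ' (fun w => draw X n (σ 1) x (σ w p)) *
      ℓ' (fun w => draw X n (σ 1) x (σ w q))) ∂(starts X m) ≤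
      2 * m * {p | ¬ Coherent n W σ p}.ncard + m * n := by
    calc _ ≤ ∑ p, ∑ q, (((if ¬ Coherent n W σ p then (1 : ℝ) else 0) +
          (if ¬ Coherent n W σ q then (1 : ℝ) else 0)) +
          (if blockOf n (σ 1) q = blockOf n (σ 1) p then (1 : ℝ) else 0)) := by
          refine Finset.sum_le_sum fun p _ => ?_
          rw [integral_finsetSum _ fun q _ => integrable_draw (σ 1)
            fun ψ => ℓ' (fun w => ψ (σ w p)) * ℓ' (fun w => ψ (σ w q))]
          exact Finset.sum_le_sum fun q _ => hpair p q
      _ ≤ ∑ p : Fin m, ((m * (if ¬ Coherent n W σ p then (1 : ℝ) else 0) +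
          {p | ¬ Coherent n W σ p}.ncard) + n) := by
          refine Finset.sum_le_sum fun p _ => ?_
          rw [Finset.sum_add_distrib, Finset.sum_add_distrib, ← hb, Finset.sum_const,
            Finset.card_univ, Fintype.card_fin, nsmul_eq_mul, Finset.sum_boole]
          have : ((Finset.univ.filter fun q =>
              blockOf n (σ 1) q = blockOf n (σ 1) p).card : ℝ) ≤ n := by
            exact_mod_cast card_fiber_blockOf_le hn (σ 1) _
          linarith
      _ = _ := by
          rw [Finset.sum_add_distrib, Finset.sum_add_distrib, ← Finset.mul_sum, ← hb]
          simp; ring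
  rw [div_le_iff₀ (by positivity)]
  refine hsum.trans (le_of_eq ?_)
  rw [incoherence]
  field_simp

/-- The random configuration is a model of the process with high probability (Chebyshev's
inequality for each local pattern). -/
theorem drawLaw_not_model_le [NeZero m] (hn : 0 < n) (hX : X.IsAction) (W : Finset ℤ)
    (σ : ℤ → Sym m) {ε : ℝ} (hε : 0 < ε) :
    (drawLaw X n (σ 1)).real {ψ | ε ≤ modelDist W σ ψ X} ≤
      (Fintype.card (W → A) : ℝ) ^ 2 / (4 * ε ^ 2) * (2 * incoherence n W σ + n / m) := by
  classical
  set N : ℝ := ((Fintype.card (W → A) : ℕ) : ℝ) with hN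
  set ℓ : (W → A) → (W → A) → ℝ := fun a => ({a} : Set (W → A)).indicator 1 with hℓ
  have hℓ01 : ∀ a b, ℓ a b ∈ Set.Icc (0 : ℝ) 1 := by
    intro a b
    simp only [hℓ, Set.indicator_apply]
    split_ifs <;> simp
  set V : (Fin m → A) → ℝ := fun ψ => ∑ a, ((∑ p, ℓ a (fun w => ψ (σ w p))) / m -
      ∫ b, ℓ a b ∂(X.localStats W)) ^ 2 with hV
  -- Cauchy-Schwarz compares the total variation distance with the sum of squares.
  have hdist : ∀ ψ : Fin m → A, 4 * modelDist W σ ψ X ^ 2 ≤ N * V ψ := by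
    intro ψ
    have hmeas : Measurable (fun p (w : W) => ψ (σ w p)) := measurable_of_finite _
    have e : ∀ a, (X.localStats W).real {a} -
        ((unif m).map (fun p (w : W) => ψ (σ w p))).real {a} =
        -((∑ p, ℓ a (fun w => ψ (σ w p))) / m - ∫ b, ℓ a b ∂(X.localStats W)) := by
      intro a
      rw [← integral_indicator_one (MeasurableSet.singleton a),
        ← integral_indicator_one (MeasurableSet.singleton a), integral_map hmeas.aemeasurable
        (Measurable.of_discrete).aestronglyMeasurable, integral_unif]
      ring
    have h := sq_sum_le_card_mul_sum_sq (s := (Finset.univ : Finset (W → A)))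
      (f := fun a => |(X.localStats W).real {a} -
        ((unif m).map (fun p (w : W) => ψ (σ w p))).real {a}|)
    simp only [sq_abs] at h
    rw [modelDist, tvDist_eq_sum]
    refine le_trans (le_of_eq (by ring)) (h.trans (le_of_eq ?_))
    rw [Finset.card_univ, hV]
    congr 1
    exact Finset.sum_congr rfl fun a _ => by rw [e, neg_sq]
  have hsub : {ψ | ε ≤ modelDist W σ ψ X} ⊆ {ψ | 4 * ε ^ 2 ≤ N * V ψ} := by
    intro ψ hψ
    refine le_trans ?_ (hdist ψ)
    have : ε ^ 2 ≤ modelDist W σ ψ X ^ 2 := pow_le_pow_left₀ hε.le hψ 2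
    linarith
  have hVnn : ∀ ψ, 0 ≤ N * V ψ := fun ψ =>
    mul_nonneg (Nat.cast_nonneg _) (Finset.sum_nonneg fun _ _ => sq_nonneg _)
  have hcheb := mul_meas_ge_le_integral_of_nonneg (μ := drawLaw X n (σ 1))
    (f := fun ψ => N * V ψ) (ae_of_all _ hVnn) Integrable.of_finite (4 * ε ^ 2)
  have hmean : ∫ ψ, N * V ψ ∂(drawLaw X n (σ 1)) ≤ N * (N * (2 * incoherence n W σ + n / m)) := by
    rw [integral_const_mul]
    refine mul_le_mul_of_nonneg_left ?_ (Nat.cast_nonneg _)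
    simp only [hV]
    rw [integral_finsetSum _ fun _ _ => Integrable.of_finite]
    refine (Finset.sum_le_sum fun a _ => integral_sq_drawLaw_sub_le hn hX W σ (hℓ01 a)).trans ?_
    rw [Finset.sum_const, nsmul_eq_mul, Finset.card_univ]
  have h1 := (mul_le_mul_of_nonneg_left (measureReal_mono (μ := drawLaw X n (σ 1)) hsub)
    (by positivity : 0 ≤ 4 * ε ^ 2)).trans (hcheb.trans hmean)
  rw [div_mul_eq_mul_div, le_div_iff₀ (by positivity)]
  linarith

/-- A law that is concentrated on a set has entropy at most about the logarithm of the size of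
that set. -/
theorem shannonEntropy_le_log_card_add {S : Type*} [Fintype S] [MeasurableSpace S]
    [MeasurableSingletonClass S] (ν : Measure S) [IsProbabilityMeasure ν] (G : Set S) :
    shannonEntropy ν ≤ Real.log 2 + Real.log G.ncard + ν.real Gᶜ * Real.log (Fintype.card S) := by
  classical
  have : Nonempty S := by
    by_contra h
    rw [not_nonempty_iff] at h
    have := measure_univ (μ := ν)
    rw [Set.univ_eq_empty_iff.2 h, measure_empty] at this
    exact zero_ne_one this
  have hS : (0 : ℝ) < Fintype.card S := by exact_mod_cast Fintype.card_pos
  have hlS : 0 ≤ Real.log (Fintype.card S) := Real.log_natCast_nonneg _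
  have hlG : 0 ≤ Real.log (G.ncard) := Real.log_natCast_nonneg _
  -- Code lengths that spend `log 2` on saying whether the point lies in `G`.
  set f : S → ℝ := fun s => Real.log 2 + (if s ∈ G then Real.log G.ncard else
    Real.log (Fintype.card S)) with hf
  have hcode : ∑ s, Real.exp (-f s) ≤ 1 := by
    have h1 : ∀ s, Real.exp (-f s) ≤ (if s ∈ G then (1 / 2) * (G.ncard : ℝ)⁻¹ else 0) +
        (1 / 2) * (Fintype.card S : ℝ)⁻¹ := by
      intro s
      have hpos : 0 < (1 / 2) * (Fintype.card S : ℝ)⁻¹ := by positivity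
      simp only [hf, neg_add, Real.exp_add]
      rw [Real.exp_neg, Real.exp_log two_pos]
      by_cases hs : s ∈ G
      · have hG : (0 : ℝ) < G.ncard := by
          exact_mod_cast (Set.ncard_pos G.toFinite).2 ⟨s, hs⟩
        rw [if_pos hs, if_pos hs, Real.exp_neg, Real.exp_log hG]
        linarith
      · rw [if_neg hs, if_neg hs, Real.exp_neg, Real.exp_log hS]
        linarith
    refine (Finset.sum_le_sum fun s _ => h1 s).trans ?_
    rw [Finset.sum_add_distrib, ← Finset.sum_filter, Finset.sum_const, Finset.sum_const,
      nsmul_eq_mul, nsmul_eq_mul, Finset.card_univ]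
    have hcard : (Finset.univ.filter fun s => s ∈ G).card = G.ncard := by
      rw [← Set.ncard_coe_finset]; congr 1; ext s; simp
    rw [hcard]
    have h2 : (G.ncard : ℝ) * ((1 / 2) * (G.ncard : ℝ)⁻¹) ≤ 1 / 2 := by
      rcases eq_or_ne (G.ncard : ℝ) 0 with h | h
      · rw [h]; norm_num
      · field_simp; exact le_refl _
    have h3 : (Fintype.card S : ℝ) * ((1 / 2) * (Fintype.card S : ℝ)⁻¹) = 1 / 2 := by
      field_simp
    linarith
  refine (shannonEntropy_le_integral ν f hcode).trans ?_
  have hfle : ∀ s, f s ≤ (Real.log 2 + Real.log G.ncard) +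
      Gᶜ.indicator (fun _ => Real.log (Fintype.card S)) s := by
    intro s
    simp only [hf]
    by_cases hs : s ∈ G
    · simp [hs]
    · simp [hs]; exact hlG
  refine (integral_mono Integrable.of_finite Integrable.of_finite hfle).trans (le_of_eq ?_)
  rw [integral_add Integrable.of_finite Integrable.of_finite,
    integral_indicator_const _ Gᶜ.toFinite.measurableSet]
  simp

/-- The entropy of the random configuration is accounted for by the number of models. -/
theorem rate_le_log_numModels [NeZero m] (hn : 0 < n) (hX : X.IsAction) (W : Finset ℤ)
    (σ : ℤ → Sym m) {ε : ℝ} (hε : 0 < ε) :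
    X.rate ≤ Real.log 2 * (1 / m) + Real.log (numModels X W ε σ) / m +
      (Fintype.card (W → A) : ℝ) ^ 2 / (4 * ε ^ 2) * (2 * incoherence n W σ + n / m) *
        Real.log (Fintype.card A) := by
  have hm : (0 : ℝ) < m := by exact_mod_cast Nat.pos_of_ne_zero (NeZero.ne m)
  have h1 := mul_rate_le_shannonEntropy_drawLaw (n := n) hX (σ 1)
  have h2 := shannonEntropy_le_log_card_add (drawLaw X n (σ 1))
    {ψ : Fin m → A | modelDist W σ ψ X < ε}
  rw [compl_models] at h2
  have h3 := drawLaw_not_model_le (n := n) hn hX W σ hε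
  have e : Real.log (Fintype.card (Fin m → A)) = m * Real.log (Fintype.card A) := by
    rw [Fintype.card_fun, Fintype.card_fin]; push_cast; rw [Real.log_pow]
  rw [e] at h2
  have h4 := mul_le_mul_of_nonneg_right h3
    (mul_nonneg hm.le (Real.log_natCast_nonneg (Fintype.card A)))
  have h5 := h1.trans (h2.trans (add_le_add_right h4 _))
  rw [← mul_le_mul_iff_right₀ hm]
  refine h5.trans (le_of_eq ?_)
  rw [numModels]
  field_simp

theorem le_soficEntropy (hX : X.IsAction) (K : RandomSoficApprox ℤ) :
    (X.rate : EReal) ≤ soficEntropy K X := by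
  refine le_iInf fun W => le_iInf₂ fun ε hε => ?_
  refine EReal.ge_of_forall_gt_iff_ge.1 fun c hc => ?_
  rw [EReal.coe_lt_coe_iff] at hc
  set l := Real.log (Fintype.card A) with hl
  have hl0 : 0 ≤ l := Real.log_natCast_nonneg _
  set C := (Fintype.card (W → A) : ℝ) ^ 2 / (4 * ε ^ 2) with hC
  have hC0 : 0 ≤ C := by positivity
  obtain ⟨R, hR⟩ : ∃ R : ℕ, ∀ w ∈ W, |w| ≤ R :=
    ⟨W.sup Int.natAbs, fun w hw => by
      have := Finset.le_sup (f := Int.natAbs) hw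
      rw [Int.abs_eq_natAbs]; exact_mod_cast this⟩
  -- Long blocks make the proportion of points near a block end small.
  obtain ⟨n, hn0, hn1, hnl⟩ : ∃ n : ℕ, 0 < n ∧ C * (4 * R / n) < 1 ∧
      C * (4 * R / n) * l < X.rate - c := by
    have t1 : Tendsto (fun n : ℕ => C * (4 * R / (n : ℝ))) atTop (𝓝 0) := by
      have := (tendsto_const_div_atTop_nhds_zero_nat (4 * (R : ℝ))).const_mul C
      rwa [mul_zero] at this
    have t2 := t1.mul_const l
    rw [zero_mul] at t2
    obtain ⟨n, h⟩ := ((eventually_gt_atTop 0).and ((t1.eventually (gt_mem_nhds one_pos)).and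
      (t2.eventually (gt_mem_nhds (sub_pos.2 hc))))).exists
    exact ⟨n, h.1, h.2.1, h.2.2⟩
  set D : ℕ → ℝ := fun i => 2 * (2 * R * (1 / n + 1 / K.m i)) + n / K.m i with hD
  have hbound : ∀ i (σ : ℤ → Sym (K.m i)), C * (2 * incoherence n W σ + n / K.m i) ≤
      C * (2 * offTrack W σ + D i) := by
    intro i σ
    refine mul_le_mul_of_nonneg_left ?_ hC0
    have := incoherence_le hn0 hR σ
    simp only [hD]
    linarith
  have hDlim : Tendsto (fun i => C * (2 * (∫ σ, offTrack W σ ∂(K.κ i)) + D i)) atTop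
      (𝓝 (C * (4 * R / n))) := by
    have h1 := (tendsto_integral_offTrack K W).const_mul (2 : ℝ)
    have h2 := (((tendsto_inv_m K).const_add (1 / (n : ℝ))).const_mul
      (2 * (R : ℝ))).const_mul (2 : ℝ)
    have h3 := (tendsto_inv_m K).const_mul (n : ℝ)
    have h4 := (h1.add (h2.add h3)).const_mul C
    have e1 : C * (2 * 0 + (2 * (2 * (R : ℝ) * (1 / n + 0)) + n * 0)) = C * (4 * R / n) := by ring
    rw [e1] at h4
    refine h4.congr fun i => ?_
    simp only [hD]
    ring
  have hmlim : Tendsto (fun i => Real.log 2 * (1 / (K.m i : ℝ)) +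
      C * (2 * (∫ σ, offTrack W σ ∂(K.κ i)) + D i) * l) atTop (𝓝 (C * (4 * R / n) * l)) := by
    have := ((tendsto_inv_m K).const_mul (Real.log 2)).add (hDlim.mul_const l)
    rwa [mul_zero, zero_add] at this
  refine le_limsup_of_frequently_le' (Eventually.frequently ?_)
  filter_upwards [hDlim.eventually (gt_mem_nhds hn1),
    hmlim.eventually (gt_mem_nhds hnl)] with i h1 h2
  have hoff := integrable_offTrack (K.κ i) W
  have hlin : Integrable (fun σ => C * (2 * offTrack W σ + D i)) (K.κ i) :=
    ((hoff.const_mul 2).add (integrable_const _)).const_mul C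
  have hlin' : ∫ σ, C * (2 * offTrack W σ + D i) ∂(K.κ i) =
      C * (2 * (∫ σ, offTrack W σ ∂(K.κ i)) + D i) := by
    rw [integral_const_mul, integral_add (hoff.const_mul 2) (integrable_const _),
      integral_const_mul]
    simp
  unfold avgLogNumModels
  split_ifs with hzero
  · -- If almost no `σ` had a model, the random configuration would never be one.
    exfalso
    have hae : ∀ᵐ σ ∂(K.κ i), (1 : ℝ) ≤ C * (2 * offTrack W σ + D i) := by
      filter_upwards [measure_eq_zero_iff_ae_notMem.1 hzero] with σ hσ
      have h0 : numModels X W ε σ = 0 := by simpa using hσ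
      have hempty : {ψ : Fin (K.m i) → A | modelDist W σ ψ X < ε} = ∅ :=
        (Set.ncard_eq_zero (Set.toFinite _)).1 h0
      have h3 := drawLaw_not_model_le (n := n) hn0 hX W σ hε
      rw [← compl_models, hempty, Set.compl_empty, probReal_univ] at h3
      exact h3.trans (hbound i σ)
    have h4 := integral_mono_ae (integrable_const _) hlin hae
    rw [hlin'] at h4
    simp only [integral_const, probReal_univ, one_smul] at h4
    linarith
  · rw [EReal.coe_le_coe_iff, ← integral_div]
    have hN := (integrable_log_numModels X W ε (K.κ i)).div_const (K.m i : ℝ)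
    have hA : Integrable (fun σ => Real.log 2 * (1 / K.m i) +
        Real.log (numModels X W ε σ) / K.m i) (K.κ i) := (integrable_const _).add hN
    have h3 : ∫ _, X.rate ∂(K.κ i) ≤ ∫ σ, ((Real.log 2 * (1 / K.m i) +
        Real.log (numModels X W ε σ) / K.m i) + C * (2 * offTrack W σ + D i) * l) ∂(K.κ i) := by
      refine integral_mono (integrable_const _) (hA.add (hlin.mul_const l)) fun σ => ?_
      have h5 := rate_le_log_numModels (n := n) hn0 hX W σ hε
      have h6 := mul_le_mul_of_nonneg_right (hbound i σ) hl0
      simp only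
      linarith
    rw [integral_add hA (hlin.mul_const l),
      integral_add (integrable_const _) hN, integral_mul_const l, hlin'] at h3
    simp only [integral_const, probReal_univ, one_smul] at h3
    linarith

end LowerSofic

end SoficZ

end

theorem mainTheorem5 {A : Type*} [Finite A] [Nonempty A] [MeasurableSpace A]
    [DiscreteMeasurableSpace A] (K : SoficZ.RandomSoficApprox ℤ)
    (X : SoficZ.ApproxProcess ℤ A) (hX : X.IsAction) :
    ∃ h : ℝ, SoficZ.HasClassicalEntropy X h ∧
      SoficZ.upperSoficEntropy K X = SoficZ.soficEntropy K X ∧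
      SoficZ.soficEntropy K X = (h : EReal) := by
  cases nonempty_fintype A
  have h1 := le_antisymm (SoficZ.upperSoficEntropy_le K X) (SoficZ.le_upperSoficEntropy hX K)
  have h2 := le_antisymm (SoficZ.soficEntropy_le K X) (SoficZ.le_soficEntropy hX K)
  exact ⟨X.rate, SoficZ.ApproxProcess.hasClassicalEntropy_rate hX, h1.trans h2.symm, h2⟩
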